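/- Let $T>0$, let $B=(B_t)_{t\ge 0}$ be a one-dimensional standard Brownian motion on a probability space $(\Omega,\mathcal F,P)$, and let $(\mathcal F_t)$ be the right-continuous filtration generated by $B$ and augmented by the $P$-null sets. Let $\Phi:\mathbb R\times[0,T]\to\mathbb R$ be a function that is continuous in $t$ and whose partial derivative $\frac{\partial\Phi}{\partial x}(x,t)$ exists and is continuous on $\mathbb R\times[0,T]$. Write $\Phi_t=\Phi(B_t,t)$ and $\Phi'_t=\frac{\partial\Phi}{\partial x}(B_t,t)$. Assume: (i) $\Phi_t$ is adapted to $(\mathcal F_t)$, and either $\Phi_t\in\mathscr L_0$ (that is, on $[0,T]$, $\Phi_t=g\,1_{\{0\}}(t)+\sum_{k\ge0}f_k\,1_{(s_k,s_{k+1}]}(t)$ with $0=s_0<s_1<\cdots\uparrow\infty$, $g$ being $\mathcal F_0$-measurable, $f_k$ being $\mathcal F_{s_k}$-measurable, all bounded by one constant), or $\Phi_t\in\mathscr L_2$ (that is, it is measurable and adapted with $E\int_0^T|\Phi_t|^2dt<\infty$) and $E[\Phi_t^4]$ is bounded on $[0,T]$; (ii) $\Phi'_t\in\mathscr L_2$,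 and $E[(\Phi'_t)^2]$ is bounded on $[0,T]$, or finite and Riemann integrable on $[0,T]$. For a partition $\Delta: 0=t_0<t_1<\dots<t_n=T$ put $\|\Delta\|=\max_j(t_{j+1}-t_j)$ and $J=\{0,\dots,n-1\}$. Assume that the following three limits in mean square of complete sums exist: $$\int_0^T\Phi(B_t,t)\circ dB_t=\mathop{\mathrm{l.i.m.}}_{\|\Delta\|\to0}\sum_{j\in J}\Phi\Big(\tfrac{B_{t_j}+B_{t_{j+1}}}2,t_j\Big)(B_{t_{j+1}}-B_{t_j}),\qquad \int_0^T\Phi(B_t,t)\,dB_t=\mathop{\mathrm{l.i.m.}}_{\|\Delta\|\to0}\sum_{j\in J}\Phi(B_{t_j},t_j)(B_{t_{j+1}}-B_{t_j}),$$ $$\int_0^T\Phi'_t\,dt=\mathop{\mathrm{l.i.m.}}_{\|\Delta\|\to0}\sum_{j\in J}\Phi'_{u_j}(t_{j+1}-t_j)\quad\text{for arbitrary }u_j\in[t_j,t_{j+1}],$$ where for the last one $\Phi'_t$ is square integrable for every $t\in[0,T]$. Then, for every fixed natural number $K$, with $J_K\subset J$ an arbitrary set of $K$ indices for each partition and with arbitrary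 $u_j\in[t_j,t_{j+1}]$, the mean-square limits of the three incomplete sums over $J\setminus J_K$ exist and equal the corresponding integrals, and almost surely $$\mathop{\mathrm{l.i.m.}}_{\|\Delta\|\to0}\sum_{j\in J\setminus J_K}\Phi\Big(\tfrac{B_{t_j}+B_{t_{j+1}}}2,t_j\Big)(B_{t_{j+1}}-B_{t_j})=\mathop{\mathrm{l.i.m.}}_{\|\Delta\|\to0}\sum_{j\in J\setminus J_K}\Phi(B_{t_j},t_j)(B_{t_{j+1}}-B_{t_j})+\frac12\mathop{\mathrm{l.i.m.}}_{\|\Delta\|\to0}\sum_{j\in J\setminus J_K}\frac{\partial\Phi}{\partial x}(B_{u_j},u_j)(t_{j+1}-t_j).$$ -/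

import Mathlib

open MeasureTheory ProbabilityTheory Filter Topology
open scoped NNReal ENNReal

noncomputable section

namespace StochSum

/-- A partition `0 = t 0 < t 1 < ⋯ < t n = T` of `[0, T]`. (The values `t i` with `i > n` are
irrelevant.) -/
structure TimePartition (T : ℝ≥0) where
  /-- the number of subintervals -/
  n : ℕ
  /-- the partition points -/
  t : ℕ → ℝ≥0
  t_zero : t 0 = 0
  t_last : t n = T
  t_lt : ∀ i < n, t i < t (i + 1)

namespace TimePartition

variable {T : ℝ≥0}

/-- The mesh `max_{0 ≤ i < n} (t (i+1) - t i)`. -/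
def mesh (π : TimePartition T) : ℝ≥0 :=
  (Finset.range π.n).sup fun i => π.t (i + 1) - π.t i

/-- `u i ∈ [t i, t (i+1)]` for every `i < n`. -/
def IsTag (π : TimePartition T) (u : ℕ → ℝ≥0) : Prop :=
  ∀ i < π.n, u i ∈ Set.Icc (π.t i) (π.t (i + 1))

end TimePartition

/-- A partition of `[0, T]` together with a set of exactly `K` deleted indices among
`0, …, n - 1`; the partition, and the deleted indices for it, are otherwise arbitrary. For
`K = 0` nothing is deleted. -/
structure DeletedPartition (T : ℝ≥0) (K : ℕ) extends TimePartition T where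
  /-- the deleted indices -/
  del : Finset ℕ
  del_subset : del ⊆ Finset.range n
  card_del : del.card = K

/-- The remaining indices `{0, …, n - 1} \ del`. -/
def DeletedPartition.kept {T : ℝ≥0} {K : ℕ} (π : DeletedPartition T K) : Finset ℕ :=
  Finset.range π.n \ π.del

/-- A `DeletedPartition` with a choice of points `u i ∈ [t i, t (i+1)]`. -/
structure TaggedDeletedPartition (T : ℝ≥0) (K : ℕ) extends DeletedPartition T K where
  /-- the chosen points -/
  u : ℕ → ℝ≥0
  isTag : toTimePartition.IsTag u

variable {Ω : Type*} {mΩ : MeasurableSpace Ω}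

/-- The sums `∑_{i ∈ J} Φ(B(t i), t i) (B(t (i+1)) - B(t i))`. -/
def itoSum {T : ℝ≥0} (Φ : ℝ → ℝ≥0 → ℝ) (B : ℝ≥0 → Ω → ℝ) (π : TimePartition T)
    (J : Finset ℕ) (ω : Ω) : ℝ :=
  ∑ i ∈ J, Φ (B (π.t i) ω) (π.t i) * (B (π.t (i + 1)) ω - B (π.t i) ω)

/-- The sums `∑_{i ∈ J} Φ((B(t i) + B(t (i+1))) / 2, t i) (B(t (i+1)) - B(t i))`. -/
def stratonovichSum {T : ℝ≥0} (Φ : ℝ → ℝ≥0 → ℝ) (B : ℝ≥0 → Ω → ℝ) (π : TimePartition T)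
    (J : Finset ℕ) (ω : Ω) : ℝ :=
  ∑ i ∈ J, Φ ((B (π.t i) ω + B (π.t (i + 1)) ω) / 2) (π.t i) *
    (B (π.t (i + 1)) ω - B (π.t i) ω)

/-- The sums `∑_{i ∈ J} X(u i) (t (i+1) - t i)`. -/
def riemannSum {T : ℝ≥0} (X : ℝ≥0 → Ω → ℝ) (π : TimePartition T) (u : ℕ → ℝ≥0)
    (J : Finset ℕ) (ω : Ω) : ℝ :=
  ∑ i ∈ J, X (u i) ω * ((π.t (i + 1) : ℝ) - (π.t i : ℝ))

/-- `Y` is the limit in mean square of the random variables `S a` as `size a → 0`: `Y` is square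
integrable and `E |S a - Y|² → 0`, uniformly over all `a` of small size. -/
def IsMeanSquareLimit {ι : Type*} (P : Measure Ω) (size : ι → ℝ≥0) (S : ι → Ω → ℝ)
    (Y : Ω → ℝ) : Prop :=
  MemLp Y 2 P ∧
    Tendsto (fun a => eLpNorm (fun ω => S a ω - Y ω) 2 P) (comap size (𝓝 0)) (𝓝 0)

/-- `Y` is the limit in mean square, as the mesh tends to `0`, of the Itô sums with `K` deleted
terms. -/
def IsIncompleteItoLimit (P : Measure Ω) (T : ℝ≥0) (K : ℕ) (Φ : ℝ → ℝ≥0 → ℝ)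
    (B : ℝ≥0 → Ω → ℝ) (Y : Ω → ℝ) : Prop :=
  IsMeanSquareLimit P (fun π : DeletedPartition T K => π.mesh)
    (fun π => itoSum Φ B π.toTimePartition π.kept) Y

/-- `Y` is the limit in mean square, as the mesh tends to `0`, of the Stratonovich sums with `K`
deleted terms. -/
def IsIncompleteStratonovichLimit (P : Measure Ω) (T : ℝ≥0) (K : ℕ) (Φ : ℝ → ℝ≥0 → ℝ)
    (B : ℝ≥0 → Ω → ℝ) (Y : Ω → ℝ) : Prop :=
  IsMeanSquareLimit P (fun π : DeletedPartition T K => π.mesh)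
    (fun π => stratonovichSum Φ B π.toTimePartition π.kept) Y

/-- `Y` is the limit in mean square, as the mesh tends to `0` and for arbitrary choice of the
points `u i`, of the Riemann sums of `X` with `K` deleted terms. -/
def IsIncompleteRiemannLimit (P : Measure Ω) (T : ℝ≥0) (K : ℕ) (X : ℝ≥0 → Ω → ℝ)
    (Y : Ω → ℝ) : Prop :=
  IsMeanSquareLimit P (fun π : TaggedDeletedPartition T K => π.mesh)
    (fun π => riemannSum X π.toTimePartition π.u π.kept) Y

/-- `Y = ∫₀ᵀ Φ(B(t), t) dB(t)` (Itô): limit in mean square of the complete sums. -/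
def IsItoIntegral (P : Measure Ω) (T : ℝ≥0) (Φ : ℝ → ℝ≥0 → ℝ) (B : ℝ≥0 → Ω → ℝ)
    (Y : Ω → ℝ) : Prop :=
  IsMeanSquareLimit P (fun π : TimePartition T => π.mesh)
    (fun π => itoSum Φ B π (Finset.range π.n)) Y

/-- `Y = ∫₀ᵀ Φ(B(t), t) ∘ dB(t)` (Stratonovich): limit in mean square of the complete sums. -/
def IsStratonovichIntegral (P : Measure Ω) (T : ℝ≥0) (Φ : ℝ → ℝ≥0 → ℝ) (B : ℝ≥0 → Ω → ℝ)
    (Y : Ω → ℝ) : Prop :=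
  IsMeanSquareLimit P (fun π : TimePartition T => π.mesh)
    (fun π => stratonovichSum Φ B π (Finset.range π.n)) Y

/-- `Y = ∫₀ᵀ X(t) dt` in the mean-square sense: `X` is a second-order process on `[0, T]` and `Y`
is the limit in mean square of its complete Riemann sums, for arbitrary partitions and points. -/
def IsMeanSquareIntegral (P : Measure Ω) (T : ℝ≥0) (X : ℝ≥0 → Ω → ℝ) (Y : Ω → ℝ) : Prop :=
  (∀ t ≤ T, MemLp (X t) 2 P) ∧
    IsMeanSquareLimit P
      (fun π : {π : TimePartition T × (ℕ → ℝ≥0) // π.1.IsTag π.2} => π.1.1.mesh)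
      (fun π => riemannSum X π.1.1 π.1.2 (Finset.range π.1.1.n)) Y

/-- `f` is Riemann integrable on `[0, T]`. -/
def IsRiemannIntegrable (T : ℝ≥0) (f : ℝ≥0 → ℝ) : Prop :=
  ∃ I : ℝ, ∀ ε > 0, ∃ δ > 0, ∀ π : TimePartition T, π.mesh < δ → ∀ u, π.IsTag u →
    |∑ i ∈ Finset.range π.n, f (u i) * ((π.t (i + 1) : ℝ) - (π.t i : ℝ)) - I| < ε

/-- The right-continuous filtration generated by `B`, augmented by the `P`-null sets:
`ℱ t = ⋂_{s > t} (σ(B r, r ≤ s) ∨ {P-null sets})`. -/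
abbrev brownianFiltration (P : Measure Ω) (B : ℝ≥0 → Ω → ℝ) (t : ℝ≥0) : MeasurableSpace Ω :=
  ⨅ s > t, ((⨆ r ≤ s, MeasurableSpace.comap (B r) (borel ℝ)) ⊔
    MeasurableSpace.generateFrom {N | P N = 0})

/-- `X` is non-anticipating (adapted) on `[0, T]`. -/
def IsNonanticipating (P : Measure Ω) (T : ℝ≥0) (B X : ℝ≥0 → Ω → ℝ) : Prop :=
  ∀ t ≤ T, Measurable[brownianFiltration P B t] (X t)

/-- The class `ℒ₀` on `[0, T]`: `X` is of the form
`g 1_{{0}}(t) + ∑ₖ f k 1_{(s k, s (k+1)]}(t)` with `0 = s 0 < s 1 < ⋯`, `s k → ∞`, with `g`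
measurable for `ℱ 0` and `f k` measurable for `ℱ (s k)`, all of them bounded by one constant. -/
def MemL0 (P : Measure Ω) (T : ℝ≥0) (B X : ℝ≥0 → Ω → ℝ) : Prop :=
  ∃ (s : ℕ → ℝ≥0) (g : Ω → ℝ) (f : ℕ → Ω → ℝ) (C : ℝ),
    s 0 = 0 ∧ StrictMono s ∧ Tendsto s atTop atTop ∧
    Measurable[brownianFiltration P B 0] g ∧
    (∀ k, Measurable[brownianFiltration P B (s k)] (f k)) ∧
    (∀ ω, |g ω| ≤ C) ∧ (∀ k ω, |f k ω| ≤ C) ∧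
    (∀ ω, X 0 ω = g ω) ∧
    ∀ k, ∀ t ∈ Set.Ioc (s k) (s (k + 1)), t ≤ T → ∀ ω, X t ω = f k ω

/-- The class `ℒ₂` on `[0, T]`: measurable adapted processes with `E ∫₀ᵀ |X t|² dt < ∞`. -/
def MemL2 (P : Measure Ω) (T : ℝ≥0) (B X : ℝ≥0 → Ω → ℝ) : Prop :=
  Measurable (fun p : Set.Iic T × Ω => X p.1 p.2) ∧
  IsNonanticipating P T B X ∧
  ∫⁻ ω, (∫⁻ t in Set.Icc (0 : ℝ) T, ‖X t.toNNReal ω‖ₑ ^ 2) ∂P < ∞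

/-- The process `Φ(B(t), t)`. -/
def composed (Φ : ℝ → ℝ≥0 → ℝ) (B : ℝ≥0 → Ω → ℝ) (t : ℝ≥0) (ω : Ω) : ℝ :=
  Φ (B t ω) t

/-- The partial derivative `∂Φ/∂x`. -/
def partialX (Φ : ℝ → ℝ≥0 → ℝ) (x : ℝ) (t : ℝ≥0) : ℝ :=
  deriv (fun y => Φ y t) x

end StochSum

end

/-! ### Uniform grids, orthogonality of Brownian sums, Gaussian moments. -/

namespace StochSum

variable {Ω : Type*} {mΩ : MeasurableSpace Ω} {P : Measure Ω}

/-! Deleting `K` terms is harmless once single terms are small in `L²`, uniformly over all intervals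
of a fine partition (`IsMeanSquareLimit.delete`). For Itô terms, independence of `Φ(B_s, s)` and the
increment gives the bound `C √(t - s)`. For Riemann terms, changing one tag in a Riemann sum shows
that a mean-square integrable process has bounded second moments
(`IsMeanSquareIntegral.exists_eLpNorm_le`).

The Stratonovich term is the hard one, because no moment of `Φ` at the midpoint is controlled.
Instead, its interval is cut into `2 ^ n` equal pieces. The complete sums before and after the cut
are both close to the Stratonovich integral, so the term is close in `L²` to the Stratonovich sum
over the pieces. Almost surely, as `n → ∞`, that sum differs by `o(1)` from the Itô sum plus half
the Riemann sum over the pieces (`ae_tendsto_gridSum`), and these have norms at most `C √d` and `M d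
/ 2`, with `d` the length of the interval. Fatou's lemma turns the almost sure `o(1)` into an `L²`
bound for the original term (`exists_eLpNorm_stratonovichTerm_le`).

The almost sure statement combines a Taylor expansion at the left endpoint with the weighted
quadratic variation of `B` along dyadic grids. Applied to the whole of `[0, T]`, again with Fatou,
it yields the conversion formula (`ae_eq_ito_add_half_riemann`). -/

lemma tendsto_comap_nhds_zero_iff {ι : Type*} (size : ι → ℝ≥0) (f : ι → ℝ≥0∞) :
    Tendsto f (comap size (𝓝 0)) (𝓝 0) ↔
      ∀ ε : ℝ≥0∞, 0 < ε → ∃ δ : ℝ≥0, 0 < δ ∧ ∀ a, size a < δ → f a ≤ ε := by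
  rw [ENNReal.tendsto_nhds_zero]
  refine forall₂_congr fun ε _ => ?_
  rw [(NNReal.nhds_zero_basis.comap size).eventually_iff]
  rfl

/-- The points `a, a + h, a + 2h, …` with `h = (b - a) / m`. -/
noncomputable def gridPoint (a b : ℝ≥0) (m i : ℕ) : ℝ≥0 := a + i * ((b - a) / m)

lemma gridPoint_zero (a b : ℝ≥0) (m : ℕ) : gridPoint a b m 0 = a := by simp [gridPoint]

lemma gridPoint_succ (a b : ℝ≥0) (m i : ℕ) :
    gridPoint a b m (i + 1) = gridPoint a b m i + (b - a) / m := by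
  simp only [gridPoint]; push_cast; ring

lemma gridPoint_last {a b : ℝ≥0} (hab : a ≤ b) {m : ℕ} (hm : m ≠ 0) :
    gridPoint a b m m = b := by
  have : (m : ℝ≥0) ≠ 0 := by exact_mod_cast hm
  rw [gridPoint, mul_div_cancel₀ _ this, add_tsub_cancel_of_le hab]

lemma gridPoint_mono (a b : ℝ≥0) (m : ℕ) : Monotone (gridPoint a b m) :=
  monotone_nat_of_le_succ fun i => by rw [gridPoint_succ]; exact le_self_add

lemma gridPoint_le {a b : ℝ≥0} (hab : a ≤ b) {m i : ℕ} (hi : i ≤ m) :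
    gridPoint a b m i ≤ b := by
  rcases eq_or_ne m 0 with rfl | hm
  · obtain rfl : i = 0 := by omega
    simpa [gridPoint] using hab
  · exact (gridPoint_mono a b m hi).trans (gridPoint_last hab hm).le

lemma gridPoint_succ_sub (a b : ℝ≥0) (m i : ℕ) :
    ((gridPoint a b m (i + 1) : ℝ≥0) : ℝ) - gridPoint a b m i = ((b - a : ℝ≥0) : ℝ) / m := by
  rw [gridPoint_succ]; push_cast; ring

lemma integrable_mul_sq_of_indepFun {X Y : Ω → ℝ} (hX : MemLp X 2 P) (hY : MemLp Y 2 P)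
    (h : IndepFun X Y P) : Integrable (fun ω => X ω ^ 2 * Y ω ^ 2) P := by
  have h2 : IndepFun (fun ω => X ω ^ 2) (fun ω => Y ω ^ 2) P :=
    h.comp (φ := fun x => x ^ 2) (ψ := fun x => x ^ 2) (by fun_prop) (by fun_prop)
  exact h2.integrable_mul hX.integrable_sq hY.integrable_sq

/-- Hölder alone would place the product only in `L¹`; independence makes `E[X² Y²]` factor, so no
fourth moments are needed. -/
lemma memLp_mul_of_indepFun {X Y : Ω → ℝ} (hX : MemLp X 2 P) (hY : MemLp Y 2 P)
    (h : IndepFun X Y P) : MemLp (fun ω => X ω * Y ω) 2 P := by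
  refine (memLp_two_iff_integrable_sq (hX.1.mul hY.1)).2 ?_
  simpa only [Pi.mul_apply, mul_pow] using integrable_mul_sq_of_indepFun hX hY h

/-- The process up to time `p m` and the increment after it are independent, applied to sums. -/
lemma indepFun_sum_increment {B : ℝ≥0 → Ω → ℝ} (hB : IsPreBrownianReal B P)
    {p : ℕ → ℝ≥0} (hp : Monotone p) {c g : ℕ → ℝ → ℝ} {m : ℕ}
    (hc : ∀ j ≤ m, Measurable (c j)) (hg : ∀ j, Measurable (g j)) :
    IndepFun (fun ω => (∑ j ∈ Finset.range m, c j (B (p j) ω) *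
        g j (B (p (j + 1)) ω - B (p j) ω), c m (B (p m) ω)))
      (fun ω => g m (B (p (m + 1)) ω - B (p m) ω)) P := by
  -- The minimum makes every time a legal index of the path up to `p m`; it changes none of the
  -- times that occur.
  let pt (r : ℝ≥0) : Set.Iic (p m) := ⟨min r (p m), Set.mem_Iic.2 (min_le_right _ _)⟩
  have hφ : Measurable fun x : Set.Iic (p m) → ℝ => (∑ j ∈ Finset.range m, c j (x (pt (p j))) *
      g j (x (pt (p (j + 1))) - x (pt (p j))), c m (x (pt (p m)))) := by
    refine Measurable.prodMk (Finset.measurable_sum _ fun j hj => ?_) ?_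
    · have := hc j (Finset.mem_range.1 hj).le
      have := hg j
      fun_prop
    · have := hc m le_rfl
      fun_prop
  have hψ : Measurable fun y : ℝ≥0 → ℝ => g m (y (p (m + 1) - p m)) := by
    have := hg m
    fun_prop
  -- Markov property: the path after `p m`, recentred at `B (p m)`, is independent of the path
  -- before.
  have h := (hB.indepFun_shift (p m)).symm.comp hφ hψ
  refine h.congr (ae_of_all _ fun ω => ?_) (ae_of_all _ fun ω => ?_)
  · simp only [Function.comp, pt]
    rw [min_self]
    congr 1
    refine Finset.sum_congr rfl fun j hj => ?_
    rw [min_eq_left (hp (Finset.mem_range.1 hj).le), min_eq_left (hp (Finset.mem_range.1 hj))]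
  · simp only [Function.comp]
    rw [add_tsub_cancel_of_le (hp (Nat.le_succ m))]

/-- Sums `∑ c j (B (p j)) * g j (B (p (j+1)) - B (p j))` with centered `g j` of the increments
are sums of orthogonal terms. -/
lemma integral_sq_sum_increment [IsProbabilityMeasure P] {B : ℝ≥0 → Ω → ℝ}
    (hB : IsPreBrownianReal B P) {p : ℕ → ℝ≥0} (hp : Monotone p) {c g : ℕ → ℝ → ℝ} {m : ℕ}
    (hc : ∀ j < m, Measurable (c j)) (hg : ∀ j, Measurable (g j))
    (hcL : ∀ j < m, MemLp (fun ω => c j (B (p j) ω)) 2 P)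
    (hgL : ∀ j, MemLp (fun ω => g j (B (p (j + 1)) ω - B (p j) ω)) 2 P)
    (hg0 : ∀ j, ∫ ω, g j (B (p (j + 1)) ω - B (p j) ω) ∂P = 0) :
    MemLp (fun ω => ∑ j ∈ Finset.range m, c j (B (p j) ω) *
        g j (B (p (j + 1)) ω - B (p j) ω)) 2 P ∧
    ∫ ω, (∑ j ∈ Finset.range m, c j (B (p j) ω) * g j (B (p (j + 1)) ω - B (p j) ω)) ^ 2 ∂P =
      ∑ j ∈ Finset.range m, (∫ ω, c j (B (p j) ω) ^ 2 ∂P) *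
        ∫ ω, g j (B (p (j + 1)) ω - B (p j) ω) ^ 2 ∂P := by
  induction m with
  | zero => simp
  | succ m ih =>
    obtain ⟨hM, hI⟩ := ih (fun j hj => hc j (by omega)) (fun j hj => hcL j (by omega))
    have hind := indepFun_sum_increment hB hp (c := c) (g := g) (m := m)
      (fun j hj => hc j (by omega)) hg
    set M : Ω → ℝ := fun ω => ∑ j ∈ Finset.range m, c j (B (p j) ω) *
        g j (B (p (j + 1)) ω - B (p j) ω) with hMdef
    set C : Ω → ℝ := fun ω => c m (B (p m) ω)
    set G : Ω → ℝ := fun ω => g m (B (p (m + 1)) ω - B (p m) ω)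
    have hC : MemLp C 2 P := hcL m (by omega)
    have hG : MemLp G 2 P := hgL m
    have hCG : IndepFun C G P := hind.comp (φ := Prod.snd) (ψ := id) measurable_snd measurable_id
    have hMCG : IndepFun (fun ω => M ω * C ω) G P :=
      hind.comp (φ := fun x : ℝ × ℝ => x.1 * x.2) (ψ := id) (by fun_prop) measurable_id
    have hCGL : MemLp (fun ω => C ω * G ω) 2 P := memLp_mul_of_indepFun hC hG hCG
    simp_rw [Finset.sum_range_succ]
    refine ⟨hM.add hCGL, ?_⟩
    have hMC : Integrable (fun ω => M ω * C ω) P := hM.integrable_mul hC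
    have hG1 : Integrable G P := hG.integrable (by norm_num)
    -- `M * C` depends only on the past of `p m`, and `G` is centred and independent of it.
    have hcross : ∫ ω, M ω * C ω * G ω ∂P = 0 := by
      have := hMCG.integral_mul_eq_mul_integral hMC.1 hG1.1
      simp only [Pi.mul_apply] at this
      rw [this, hg0 m, mul_zero]
    have hsq : ∫ ω, C ω ^ 2 * G ω ^ 2 ∂P = (∫ ω, C ω ^ 2 ∂P) * ∫ ω, G ω ^ 2 ∂P := by
      have h2 : IndepFun (fun ω => C ω ^ 2) (fun ω => G ω ^ 2) P :=
        hCG.comp (φ := fun x => x ^ 2) (ψ := fun x => x ^ 2) (by fun_prop) (by fun_prop)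
      simpa only [Pi.mul_apply] using
        h2.integral_mul_eq_mul_integral hC.integrable_sq.1 hG.integrable_sq.1
    have hi1 : Integrable (fun ω => M ω ^ 2) P := hM.integrable_sq
    have hi2 : Integrable (fun ω => M ω * C ω * G ω) P := hMCG.integrable_mul hMC hG1
    have hi12 : Integrable (fun ω => M ω ^ 2 + 2 * (M ω * C ω * G ω)) P :=
      hi1.add (hi2.const_mul 2)
    have hi3 := integrable_mul_sq_of_indepFun hC hG hCG
    calc ∫ ω, (M ω + C ω * G ω) ^ 2 ∂P
        = ∫ ω, (M ω ^ 2 + 2 * (M ω * C ω * G ω)) + C ω ^ 2 * G ω ^ 2 ∂P := by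
          congr 1; ext ω; ring
      _ = _ := by
          rw [integral_add hi12 hi3, integral_add hi1 (hi2.const_mul 2),
            integral_const_mul, hcross, hsq, hI]
          ring

lemma hasLaw_increment {B : ℝ≥0 → Ω → ℝ} (hB : IsPreBrownianReal B P) {s t : ℝ≥0} (hst : s ≤ t) :
    HasLaw (fun ω => B t ω - B s ω) (gaussianReal 0 (t - s)) P := by
  have h := hB.hasLaw_sub t s
  have e : nndist t.1 s.1 = t - s := by
    apply NNReal.coe_injective
    rw [coe_nndist, NNReal.coe_sub hst, Real.dist_eq]
    exact abs_of_nonneg (sub_nonneg.2 hst)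
  rwa [e] at h

lemma integral_sq_gaussianReal_zero (v : ℝ≥0) : ∫ x, x ^ 2 ∂gaussianReal 0 v = v := by
  have h := variance_fun_id_gaussianReal (μ := 0) (v := v)
  rw [variance_eq_integral (by fun_prop)] at h
  simpa using h

lemma integrable_pow_gaussianReal (v : ℝ≥0) (k : ℕ) :
    Integrable (fun x : ℝ => x ^ k) (gaussianReal 0 v) := by
  have h := (memLp_id_gaussianReal (μ := 0) (v := v) (k : ℝ≥0))
  exact (integrable_norm_iff (by fun_prop)).1 (by simpa using h.integrable_norm_pow')

lemma memLp_sq_sub_gaussianReal (v : ℝ≥0) (w : ℝ) :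
    MemLp (fun x : ℝ => x ^ 2 - w) 2 (gaussianReal 0 v) := by
  rw [memLp_two_iff_integrable_sq (by fun_prop)]
  have : (fun x : ℝ => (x ^ 2 - w) ^ 2) = fun x => x ^ 4 - 2 * w * x ^ 2 + w ^ 2 := by
    ext x; ring
  rw [this]
  exact ((integrable_pow_gaussianReal v 4).sub
    ((integrable_pow_gaussianReal v 2).const_mul _)).add (integrable_const _)

/-- Brownian scaling: a `N(0, v)` variable is `√v` times a standard one. Only the factor `v ^ 2`
matters later, so the constant is not evaluated. -/
lemma integral_sq_sub_sq_gaussianReal (v : ℝ≥0) :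
    ∫ x, (x ^ 2 - (v : ℝ)) ^ 2 ∂gaussianReal 0 v =
      v ^ 2 * ∫ x, (x ^ 2 - 1) ^ 2 ∂gaussianReal 0 1 := by
  have h := gaussianReal_map_const_mul (μ := 0) (v := 1) (√(v : ℝ))
  have e : NNReal.mk (√(v : ℝ) ^ 2) (sq_nonneg _) * 1 = v := by
    ext; simp
  rw [mul_zero, e] at h
  rw [← h, integral_map (by fun_prop) (by fun_prop), ← integral_const_mul]
  refine integral_congr_ae (ae_of_all _ fun x => ?_)
  have : √(v : ℝ) ^ 2 = v := Real.sq_sqrt v.2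
  simp only [mul_pow, this]
  ring

end StochSum

/-! ### Square-norm bounds and quadratic variation on uniform grids. -/

namespace StochSum

variable {Ω : Type*} {mΩ : MeasurableSpace Ω} {P : Measure Ω}

lemma eLpNorm_two_sq (X : Ω → ℝ) : eLpNorm X 2 P ^ 2 = ∫⁻ ω, ‖X ω‖ₑ ^ 2 ∂P := by
  have h := eLpNorm_nnreal_pow_eq_lintegral (μ := P) (f := X) (p := 2) (by norm_num)
  norm_num at h
  exact_mod_cast h

lemma lintegral_enorm_sq_eq_ofReal {X : Ω → ℝ} (hX : MemLp X 2 P) :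
    ∫⁻ ω, ‖X ω‖ₑ ^ 2 ∂P = ENNReal.ofReal (∫ ω, X ω ^ 2 ∂P) := by
  rw [ofReal_integral_eq_lintegral_ofReal hX.integrable_sq (ae_of_all _ fun ω => sq_nonneg _)]
  refine lintegral_congr fun ω => ?_
  rw [← sq_abs, ENNReal.ofReal_pow (abs_nonneg _), Real.enorm_eq_ofReal_abs]

lemma eLpNorm_two_le_iff {X : Ω → ℝ} (hX : MemLp X 2 P) (c : ℝ≥0) :
    eLpNorm X 2 P ≤ c ↔ ∫ ω, X ω ^ 2 ∂P ≤ (c : ℝ) ^ 2 := by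
  rw [← ENNReal.ofReal_le_ofReal_iff (by positivity), ← lintegral_enorm_sq_eq_ofReal hX,
    ← eLpNorm_two_sq, ENNReal.ofReal_pow (NNReal.coe_nonneg c), ENNReal.ofReal_coe_nnreal]
  exact (ENNReal.pow_le_pow_left_iff two_ne_zero).symm

section Increment

variable {B : ℝ≥0 → Ω → ℝ} {s t : ℝ≥0}

lemma memLp_increment (hB : IsPreBrownianReal B P) (hst : s ≤ t) :
    MemLp (fun ω => B t ω - B s ω) 2 P :=
  (hasLaw_increment hB hst).hasGaussianLaw.memLp_two

lemma integral_increment (hB : IsPreBrownianReal B P) (hst : s ≤ t) :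
    ∫ ω, (B t ω - B s ω) ∂P = 0 := by
  rw [(hasLaw_increment hB hst).integral_eq, integral_id_gaussianReal]

lemma integral_comp_increment (hB : IsPreBrownianReal B P) (hst : s ≤ t) {f : ℝ → ℝ}
    (hf : Measurable f) :
    ∫ ω, f (B t ω - B s ω) ∂P = ∫ x, f x ∂gaussianReal 0 (t - s) :=
  (hasLaw_increment hB hst).integral_comp hf.aestronglyMeasurable

lemma integral_sq_increment (hB : IsPreBrownianReal B P) (hst : s ≤ t) :
    ∫ ω, (B t ω - B s ω) ^ 2 ∂P = (t - s : ℝ≥0) := by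
  rw [integral_comp_increment hB hst (f := fun x => x ^ 2) (by fun_prop),
    integral_sq_gaussianReal_zero]

lemma memLp_sq_increment_sub (hB : IsPreBrownianReal B P) (hst : s ≤ t) (w : ℝ) :
    MemLp (fun ω => (B t ω - B s ω) ^ 2 - w) 2 P := by
  have hl := hasLaw_increment hB hst
  have h := memLp_sq_sub_gaussianReal (t - s) w
  rw [← hl.map_eq] at h
  exact h.comp_of_map hl.aemeasurable

lemma integral_sq_increment_sub (hB : IsPreBrownianReal B P) (hst : s ≤ t) :
    ∫ ω, ((B t ω - B s ω) ^ 2 - (t - s : ℝ≥0)) ∂P = 0 := by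
  rw [integral_comp_increment hB hst (f := fun x => x ^ 2 - (t - s : ℝ≥0)) (by fun_prop)]
  have : IsProbabilityMeasure (gaussianReal 0 (t - s)) := inferInstance
  rw [integral_sub (integrable_pow_gaussianReal _ 2) (integrable_const _),
    integral_sq_gaussianReal_zero]
  simp

end Increment

variable [IsProbabilityMeasure P] {B : ℝ≥0 → Ω → ℝ} {T a b : ℝ≥0} {Φ : ℝ → ℝ≥0 → ℝ}

/-- The Itô sum over a uniform grid is bounded in `L²` by the length of the interval. -/
lemma eLpNorm_ito_grid_le (hBm : ∀ t, Measurable (B t)) (hB : IsPreBrownianReal B P)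
    (hΦ : ∀ t ≤ T, Measurable fun x => Φ x t) {C : ℝ≥0}
    (hC : ∀ t ≤ T, eLpNorm (composed Φ B t) 2 P ≤ C) (hab : a ≤ b) (hbT : b ≤ T) (m : ℕ) :
    MemLp (fun ω => ∑ i ∈ Finset.range m, Φ (B (gridPoint a b m i) ω) (gridPoint a b m i) *
      (B (gridPoint a b m (i + 1)) ω - B (gridPoint a b m i) ω)) 2 P ∧
    eLpNorm (fun ω => ∑ i ∈ Finset.range m, Φ (B (gridPoint a b m i) ω) (gridPoint a b m i) *
      (B (gridPoint a b m (i + 1)) ω - B (gridPoint a b m i) ω)) 2 P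
      ≤ (C * NNReal.sqrt (b - a) : ℝ≥0) := by
  set p := gridPoint a b m with hpdef
  have hp : Monotone p := gridPoint_mono a b m
  have hpT : ∀ i < m, p i ≤ T := fun i hi => (gridPoint_le hab hi.le).trans hbT
  have hcL : ∀ j < m, MemLp (fun ω => Φ (B (p j) ω) (p j)) 2 P := fun j hj =>
    ⟨((hΦ _ (hpT j hj)).comp (hBm _)).aestronglyMeasurable,
      (hC _ (hpT j hj)).trans_lt ENNReal.coe_lt_top⟩
  obtain ⟨h1, h2⟩ := integral_sq_sum_increment hB hp (c := fun j x => Φ x (p j))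
    (g := fun _ x => x) (m := m) (fun j hj => hΦ _ (hpT j hj)) (fun _ => measurable_id) hcL
    (fun j => memLp_increment hB (hp j.le_succ)) (fun j => integral_increment hB (hp j.le_succ))
  refine ⟨h1, (eLpNorm_two_le_iff h1 _).2 ?_⟩
  rw [h2]
  have hterm : ∀ j ∈ Finset.range m, (∫ ω, Φ (B (p j) ω) (p j) ^ 2 ∂P) *
      ∫ ω, (B (p (j + 1)) ω - B (p j) ω) ^ 2 ∂P ≤ (C : ℝ) ^ 2 * (((b - a : ℝ≥0) : ℝ) / m) := by
    intro j hj
    rw [integral_sq_increment hB (hp j.le_succ), NNReal.coe_sub (hp j.le_succ), hpdef,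
      gridPoint_succ_sub]
    have := (eLpNorm_two_le_iff (hcL j (Finset.mem_range.1 hj)) C).1
      (hC _ (hpT j (Finset.mem_range.1 hj)))
    gcongr
  refine (Finset.sum_le_sum hterm).trans ?_
  rw [Finset.sum_const, Finset.card_range, nsmul_eq_mul, NNReal.coe_mul, mul_pow, Real.coe_sqrt,
    Real.sq_sqrt (NNReal.coe_nonneg _)]
  rcases eq_or_ne m 0 with rfl | hm
  · simp; positivity
  · apply le_of_eq; field_simp

/-- Weighted quadratic variation: `∑ h (B, t) (ΔB² - Δt)` tends to `0` along dyadic grids. -/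
lemma ae_tendsto_dyadic_quadratic (hBm : ∀ t, Measurable (B t)) (hB : IsPreBrownianReal B P)
    {h : ℝ → ℝ≥0 → ℝ} (hh : ∀ t ≤ T, Measurable fun x => h x t) {C : ℝ} (hC : ∀ x t, |h x t| ≤ C)
    (hab : a ≤ b) (hbT : b ≤ T) :
    ∀ᵐ ω ∂P, Tendsto (fun n : ℕ => ∑ i ∈ Finset.range (2 ^ n),
      h (B (gridPoint a b (2 ^ n) i) ω) (gridPoint a b (2 ^ n) i) *
      ((B (gridPoint a b (2 ^ n) (i + 1)) ω - B (gridPoint a b (2 ^ n) i) ω) ^ 2 -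
        ((b - a : ℝ≥0) : ℝ) / (2 ^ n : ℕ))) atTop (𝓝 0) := by
  set κ : ℝ := ∫ x, (x ^ 2 - 1) ^ 2 ∂gaussianReal 0 1
  set X : ℕ → Ω → ℝ := fun n ω => ∑ i ∈ Finset.range (2 ^ n),
      h (B (gridPoint a b (2 ^ n) i) ω) (gridPoint a b (2 ^ n) i) *
      ((B (gridPoint a b (2 ^ n) (i + 1)) ω - B (gridPoint a b (2 ^ n) i) ω) ^ 2 -
        ((b - a : ℝ≥0) : ℝ) / (2 ^ n : ℕ)) with hX
  have hκ : 0 ≤ κ := integral_nonneg fun x => sq_nonneg _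
  -- There are `2 ^ n` orthogonal terms, each of second moment `O(4 ^ (-n))`, whence the geometric
  -- rate.
  have key : ∀ n, MemLp (X n) 2 P ∧
      ∫ ω, X n ω ^ 2 ∂P ≤ (C ^ 2 * κ * ((b - a : ℝ≥0) : ℝ) ^ 2) * (1 / 2) ^ n := by
    intro n
    set m := 2 ^ n with hm
    set p := gridPoint a b m with hpdef
    have hp : Monotone p := gridPoint_mono a b m
    have hpT : ∀ i < m, p i ≤ T := fun i hi => (gridPoint_le hab hi.le).trans hbT
    have hstep : ∀ j, ((p (j + 1) - p j : ℝ≥0) : ℝ) = ((b - a : ℝ≥0) : ℝ) / m := fun j => by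
      rw [NNReal.coe_sub (hp j.le_succ), hpdef, gridPoint_succ_sub]
    have hcL : ∀ j < m, MemLp (fun ω => h (B (p j) ω) (p j)) 2 P := fun j hj =>
      MemLp.of_bound ((hh _ (hpT j hj)).comp (hBm _)).aestronglyMeasurable C
        (ae_of_all _ fun ω => hC _ _)
    obtain ⟨h1, h2⟩ := integral_sq_sum_increment hB hp (c := fun j x => h x (p j))
      (g := fun _ x => x ^ 2 - ((b - a : ℝ≥0) : ℝ) / m) (m := m) (fun j hj => hh _ (hpT j hj))
      (fun _ => by fun_prop) hcL (fun j => memLp_sq_increment_sub hB (hp j.le_succ) _)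
      (fun j => by rw [← hstep j]; exact integral_sq_increment_sub hB (hp j.le_succ))
    refine ⟨h1, ?_⟩
    rw [hX]
    simp only
    rw [h2]
    have hterm : ∀ j ∈ Finset.range m, (∫ ω, h (B (p j) ω) (p j) ^ 2 ∂P) *
        ∫ ω, ((B (p (j + 1)) ω - B (p j) ω) ^ 2 - ((b - a : ℝ≥0) : ℝ) / m) ^ 2 ∂P ≤
        C ^ 2 * ((((b - a : ℝ≥0) : ℝ) / m) ^ 2 * κ) := by
      intro j hj
      rw [← hstep j, integral_comp_increment hB (hp j.le_succ)
        (f := fun x => (x ^ 2 - ((p (j + 1) - p j : ℝ≥0) : ℝ)) ^ 2) (by fun_prop),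
        integral_sq_sub_sq_gaussianReal]
      have : ∫ ω, h (B (p j) ω) (p j) ^ 2 ∂P ≤ C ^ 2 := by
        calc _ ≤ ∫ ω, C ^ 2 ∂P := integral_mono_of_nonneg (ae_of_all _ fun ω => sq_nonneg _)
              (integrable_const _) (ae_of_all _ fun ω => sq_le_sq' (abs_le.1 (hC _ _)).1
                (abs_le.1 (hC _ _)).2)
          _ = C ^ 2 := by simp
      gcongr
    refine (Finset.sum_le_sum hterm).trans (le_of_eq ?_)
    rw [Finset.sum_const, Finset.card_range, nsmul_eq_mul, hm]
    push_cast
    have : (2 : ℝ) ^ n ≠ 0 := by positivity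
    rw [one_div, inv_pow]
    field_simp
  -- Summable second moments make `∑ X n ^ 2` finite almost surely, which upgrades `L²` convergence
  -- to almost sure convergence without passing to a subsequence.
  have hsum : ∫⁻ ω, ∑' n, ‖X n ω‖ₑ ^ 2 ∂P ≠ ∞ := by
    rw [lintegral_tsum fun n => (key n).1.1.enorm.pow_const 2]
    have hs : Summable fun n : ℕ =>
        (C ^ 2 * κ * ((b - a : ℝ≥0) : ℝ) ^ 2) * (1 / 2 : ℝ) ^ n :=
      (summable_geometric_of_lt_one (by norm_num) (by norm_num)).mul_left _
    refine ne_top_of_le_ne_top hs.tsum_ofReal_ne_top (ENNReal.tsum_le_tsum fun n => ?_)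
    rw [lintegral_enorm_sq_eq_ofReal (key n).1]
    exact ENNReal.ofReal_le_ofReal (key n).2
  have hae := ae_lt_top' (AEMeasurable.tsum fun n => (key n).1.1.enorm.pow_const 2) hsum
  filter_upwards [hae] with ω hω
  have h0 := ENNReal.tendsto_atTop_zero_of_tsum_ne_top hω.ne
  have h1 : Tendsto (fun n => (‖X n ω‖ₑ ^ 2).toReal) atTop (𝓝 0) := by
    exact (ENNReal.tendsto_toReal ENNReal.zero_ne_top).comp h0
  have h2 : Tendsto (fun n => X n ω ^ 2) atTop (𝓝 0) := by
    simpa using h1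
  have h3 := h2.sqrt
  simp only [Real.sqrt_sq_eq_abs, Real.sqrt_zero] at h3
  exact (tendsto_zero_iff_abs_tendsto_zero _).2 h3

end StochSum

/-! ### Pathwise Taylor expansion along dyadic grids. -/

namespace StochSum

variable {Ω : Type*} {mΩ : MeasurableSpace Ω} {P : Measure Ω}

/-- Truncation at level `N`. -/
def clamp (N : ℕ) (y : ℝ) : ℝ := max (-N) (min N y)

lemma abs_clamp_le (N : ℕ) (y : ℝ) : |clamp N y| ≤ N := by
  have : (0 : ℝ) ≤ N := N.cast_nonneg
  exact abs_le.2 ⟨le_max_left _ _, max_le (by linarith) (min_le_left _ _)⟩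

lemma clamp_of_abs_le {N : ℕ} {y : ℝ} (h : |y| ≤ N) : clamp N y = y := by
  rw [clamp, min_eq_right (abs_le.1 h).2, max_eq_right (abs_le.1 h).1]

lemma continuous_clamp (N : ℕ) : Continuous (clamp N) := by unfold clamp; fun_prop

variable {T a b : ℝ≥0} {Φ : ℝ → ℝ≥0 → ℝ}

/-- Mean value inequality for `z ↦ f z - f'(x) z` between `x` and the midpoint. The midpoint lies at
distance `|y - x| / 2` from `x`, which is the origin of the factor `1 / 2` in the conversion
formula. -/
lemma abs_midpoint_increment_le {f : ℝ → ℝ} (hf : Differentiable ℝ f) {x y η : ℝ}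
    (h : ∀ z ∈ Set.uIcc x y, |deriv f z - deriv f x| ≤ η) :
    |(f ((x + y) / 2) - f x) * (y - x) - 1 / 2 * deriv f x * (y - x) ^ 2| ≤
      η * (y - x) ^ 2 / 2 := by
  have hmid : (x + y) / 2 ∈ Set.uIcc x y := by
    rcases le_total x y with hxy | hxy
    · rw [Set.uIcc_of_le hxy]; constructor <;> linarith
    · rw [Set.uIcc_of_ge hxy]; constructor <;> linarith
  have hg : ∀ z, HasDerivAt (fun z => f z - deriv f x * z) (deriv f z - deriv f x) z := fun z => by
    have := (hf z).hasDerivAt.sub ((hasDerivAt_id z).const_mul (deriv f x))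
    rw [mul_one] at this
    exact this
  have := Convex.norm_image_sub_le_of_norm_hasDerivWithin_le (s := Set.uIcc x y)
    (f := fun z => f z - deriv f x * z) (f' := fun z => deriv f z - deriv f x) (C := η)
    (fun z _ => (hg z).hasDerivWithinAt) h (convex_uIcc x y) Set.left_mem_uIcc hmid
  rw [Real.norm_eq_abs, Real.norm_eq_abs] at this
  have e : (f ((x + y) / 2) - f x) * (y - x) - 1 / 2 * deriv f x * (y - x) ^ 2 =
      (f ((x + y) / 2) - deriv f x * ((x + y) / 2) - (f x - deriv f x * x)) * (y - x) := by ring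
  have e2 : |(x + y) / 2 - x| = |y - x| / 2 := by
    rw [← abs_two (α := ℝ), ← abs_div, abs_two]; congr 1; ring
  rw [e, abs_mul]
  rw [e2] at this
  calc _ ≤ η * (|y - x| / 2) * |y - x| := by gcongr
    _ = η * (y - x) ^ 2 / 2 := by rw [← sq_abs (y - x)]; ring

/-- Along a continuous path with the right (weighted) quadratic variation, the difference of the
midpoint sums and left endpoint sums is asymptotically half of the Riemann sums of `∂Φ/∂x`. -/
lemma tendsto_dyadic_of_quadratic (hΦd : ∀ t ≤ T, Differentiable ℝ (fun x => Φ x t))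
    (hΦx : ContinuousOn (fun p : ℝ × ℝ≥0 => partialX Φ p.1 p.2) (Set.univ ×ˢ Set.Iic T))
    (hab : a ≤ b) (hbT : b ≤ T) {x : ℝ≥0 → ℝ} (hx : Continuous x)
    (h1 : Tendsto (fun n : ℕ => ∑ i ∈ Finset.range (2 ^ n),
      ((x (gridPoint a b (2 ^ n) (i + 1)) - x (gridPoint a b (2 ^ n) i)) ^ 2 -
        ((b - a : ℝ≥0) : ℝ) / (2 ^ n : ℕ))) atTop (𝓝 0))
    (h2 : ∀ N : ℕ, Tendsto (fun n : ℕ => ∑ i ∈ Finset.range (2 ^ n),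
      clamp N (partialX Φ (x (gridPoint a b (2 ^ n) i)) (gridPoint a b (2 ^ n) i)) *
      ((x (gridPoint a b (2 ^ n) (i + 1)) - x (gridPoint a b (2 ^ n) i)) ^ 2 -
        ((b - a : ℝ≥0) : ℝ) / (2 ^ n : ℕ))) atTop (𝓝 0)) :
    Tendsto (fun n : ℕ =>
      (∑ i ∈ Finset.range (2 ^ n),
        Φ ((x (gridPoint a b (2 ^ n) i) + x (gridPoint a b (2 ^ n) (i + 1))) / 2)
          (gridPoint a b (2 ^ n) i) *
        (x (gridPoint a b (2 ^ n) (i + 1)) - x (gridPoint a b (2 ^ n) i))) -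
      (∑ i ∈ Finset.range (2 ^ n),
        Φ (x (gridPoint a b (2 ^ n) i)) (gridPoint a b (2 ^ n) i) *
        (x (gridPoint a b (2 ^ n) (i + 1)) - x (gridPoint a b (2 ^ n) i))) -
      1 / 2 * ∑ i ∈ Finset.range (2 ^ n),
        partialX Φ (x (gridPoint a b (2 ^ n) i)) (gridPoint a b (2 ^ n) i) *
        ((gridPoint a b (2 ^ n) (i + 1) : ℝ) - (gridPoint a b (2 ^ n) i : ℝ))) atTop (𝓝 0) := by
  have hIic : Set.Iic T = Set.Icc 0 T := by ext; simp
  have hIc : IsCompact (Set.Iic T) := hIic ▸ isCompact_Icc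
  obtain ⟨r, hr⟩ : ∃ r : ℝ, ∀ t ≤ T, x t ∈ Set.Icc (-r) r := by
    obtain ⟨r, hr⟩ := hIc.exists_bound_of_continuousOn hx.continuousOn
    exact ⟨r, fun t ht => abs_le.1 (hr t ht)⟩
  set K : Set (ℝ × ℝ≥0) := Set.Icc (-r) r ×ˢ Set.Iic T with hK
  have hKc : IsCompact K := isCompact_Icc.prod hIc
  have hKcont : ContinuousOn (fun p : ℝ × ℝ≥0 => partialX Φ p.1 p.2) K :=
    hΦx.mono (Set.prod_mono (Set.subset_univ _) le_rfl)
  -- The truncation level depends on the path: for this `N` the clamp is inactive along `x`, while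
  -- the probabilistic estimate needed bounded weights.
  obtain ⟨N, hN⟩ : ∃ N : ℕ, ∀ p ∈ K, |partialX Φ p.1 p.2| ≤ N := by
    obtain ⟨C, hC⟩ := hKc.exists_bound_of_continuousOn hKcont
    obtain ⟨N, hN⟩ := exists_nat_ge C
    exact ⟨N, fun p hp => (hC p hp).trans hN⟩
  have hKu := hKc.uniformContinuousOn_of_continuous hKcont
  have hxu := hIc.uniformContinuousOn_of_continuous hx.continuousOn
  have hgT : ∀ n i, i ≤ 2 ^ n → gridPoint a b (2 ^ n) i ≤ T := fun n i hi =>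
    (gridPoint_le hab hi).trans hbT
  set Q : ℕ → ℝ := fun n => ∑ i ∈ Finset.range (2 ^ n),
      (x (gridPoint a b (2 ^ n) (i + 1)) - x (gridPoint a b (2 ^ n) i)) ^ 2 with hQ
  have hQlim : Tendsto Q atTop (𝓝 ((b - a : ℝ≥0) : ℝ)) := by
    have := h1.add_const ((b - a : ℝ≥0) : ℝ)
    rw [zero_add] at this
    refine this.congr fun n => ?_
    rw [Finset.sum_sub_distrib, Finset.sum_const, Finset.card_range, nsmul_eq_mul]
    push_cast
    have : (2 : ℝ) ^ n ≠ 0 := by positivity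
    field_simp
    simp [hQ]
  -- The quadratic sums converge to `b - a`, so they are eventually at most `L`; this bounds the
  -- accumulated Taylor error.
  set L : ℝ := ((b - a : ℝ≥0) : ℝ) + 1 with hL
  have hLpos : 0 < L := by positivity
  have hQL : ∀ᶠ n in atTop, Q n ≤ L :=
    (hQlim.eventually_lt_const (lt_add_one _)).mono fun n hn => hn.le
  -- the mesh of the dyadic grids tends to zero
  have hmesh : Tendsto (fun n : ℕ => ((b - a : ℝ≥0) : ℝ) / (2 ^ n : ℕ)) atTop (𝓝 0) := by
    have := (tendsto_pow_atTop_nhds_zero_of_lt_one (r := (1 / 2 : ℝ)) (by norm_num)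
      (by norm_num)).const_mul ((b - a : ℝ≥0) : ℝ)
    rw [mul_zero] at this
    refine this.congr fun n => ?_
    push_cast
    rw [one_div, inv_pow, div_eq_mul_inv]
  -- Taylor error
  have hE : Tendsto (fun n : ℕ => ∑ i ∈ Finset.range (2 ^ n),
      ((Φ ((x (gridPoint a b (2 ^ n) i) + x (gridPoint a b (2 ^ n) (i + 1))) / 2)
          (gridPoint a b (2 ^ n) i) -
        Φ (x (gridPoint a b (2 ^ n) i)) (gridPoint a b (2 ^ n) i)) *
        (x (gridPoint a b (2 ^ n) (i + 1)) - x (gridPoint a b (2 ^ n) i)) -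
      1 / 2 * partialX Φ (x (gridPoint a b (2 ^ n) i)) (gridPoint a b (2 ^ n) i) *
        (x (gridPoint a b (2 ^ n) (i + 1)) - x (gridPoint a b (2 ^ n) i)) ^ 2)) atTop (𝓝 0) := by
    rw [Metric.tendsto_atTop]
    intro ε hε
    obtain ⟨δ, hδ, hδK⟩ := Metric.uniformContinuousOn_iff.1 hKu (ε / L) (by positivity)
    obtain ⟨δ', hδ', hδx⟩ := Metric.uniformContinuousOn_iff.1 hxu δ hδ
    obtain ⟨n₀, hn₀⟩ := eventually_atTop.1 (hQL.and (hmesh.eventually_lt_const hδ'))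
    refine ⟨n₀, fun n hn => ?_⟩
    obtain ⟨hQn, hmn⟩ := hn₀ n hn
    rw [Real.dist_eq, sub_zero]
    calc _ ≤ ∑ i ∈ Finset.range (2 ^ n), ε / L *
          (x (gridPoint a b (2 ^ n) (i + 1)) - x (gridPoint a b (2 ^ n) i)) ^ 2 / 2 := by
          refine (Finset.abs_sum_le_sum_abs _ _).trans (Finset.sum_le_sum fun i hi => ?_)
          have hi' : i < 2 ^ n := Finset.mem_range.1 hi
          have hiT := hgT n i hi'.le
          have hiT' := hgT n (i + 1) hi'
          have hsub : Set.uIcc (x (gridPoint a b (2 ^ n) i)) (x (gridPoint a b (2 ^ n) (i + 1))) ⊆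
              Set.Icc (-r) r := Set.uIcc_subset_Icc (hr _ hiT) (hr _ hiT')
          have hdist : dist (x (gridPoint a b (2 ^ n) (i + 1))) (x (gridPoint a b (2 ^ n) i)) < δ := by
            refine hδx _ hiT' _ hiT ?_
            rw [NNReal.dist_eq, gridPoint_succ_sub, abs_of_nonneg (by positivity)]
            exact hmn
          refine abs_midpoint_increment_le (hΦd _ hiT) fun z hz => ?_
          have hz' : |z - x (gridPoint a b (2 ^ n) i)| ≤ _ := Set.abs_sub_left_of_mem_uIcc hz
          have := hδK (z, gridPoint a b (2 ^ n) i) ⟨hsub hz, hiT⟩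
            (x (gridPoint a b (2 ^ n) i), gridPoint a b (2 ^ n) i) ⟨hr _ hiT, hiT⟩
            (by
              rw [Prod.dist_eq, dist_self, max_eq_left dist_nonneg]
              exact hz'.trans_lt hdist)
          exact this.le
      _ = ε / L * Q n / 2 := by rw [hQ, Finset.mul_sum, Finset.sum_div]
      _ ≤ ε / L * L / 2 := by gcongr
      _ < ε := by rw [div_mul_cancel₀ _ hLpos.ne']; linarith
  -- The weighted quadratic variation replaces the squared increments of the second-order term by
  -- time increments.
  have := hE.add ((h2 N).const_mul (1 / 2))
  rw [mul_zero, add_zero] at this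
  refine this.congr fun n => ?_
  rw [Finset.mul_sum, Finset.mul_sum, ← Finset.sum_add_distrib, ← Finset.sum_sub_distrib,
    ← Finset.sum_sub_distrib]
  refine Finset.sum_congr rfl fun i hi => ?_
  have hiT := hgT n i (Finset.mem_range.1 hi).le
  rw [clamp_of_abs_le (hN (x (gridPoint a b (2 ^ n) i), gridPoint a b (2 ^ n) i)
    ⟨hr _ hiT, hiT⟩), gridPoint_succ_sub]
  ring

/-- The sum of `F` over the intervals of the uniform grid. -/
noncomputable def gridSum (F : ℝ≥0 → ℝ≥0 → Ω → ℝ) (a b : ℝ≥0) (m : ℕ) (ω : Ω) : ℝ :=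
  ∑ i ∈ Finset.range m, F (gridPoint a b m i) (gridPoint a b m (i + 1)) ω

/-- `Φ (B s, s) (B t - B s)`. -/
def itoTerm (Φ : ℝ → ℝ≥0 → ℝ) (B : ℝ≥0 → Ω → ℝ) (s t : ℝ≥0) (ω : Ω) : ℝ :=
  Φ (B s ω) s * (B t ω - B s ω)

/-- `Φ ((B s + B t) / 2, s) (B t - B s)`. -/
noncomputable def stratonovichTerm (Φ : ℝ → ℝ≥0 → ℝ) (B : ℝ≥0 → Ω → ℝ) (s t : ℝ≥0) (ω : Ω) : ℝ :=
  Φ ((B s ω + B t ω) / 2) s * (B t ω - B s ω)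

/-- `X s (t - s)`. -/
def riemannTerm (X : ℝ≥0 → Ω → ℝ) (s t : ℝ≥0) (ω : Ω) : ℝ := X s ω * ((t : ℝ) - s)

lemma measurable_partialX (hΦx : ContinuousOn (fun p : ℝ × ℝ≥0 => partialX Φ p.1 p.2)
    (Set.univ ×ˢ Set.Iic T)) {t : ℝ≥0} (ht : t ≤ T) : Measurable fun x => partialX Φ x t := by
  refine Continuous.measurable ?_
  have := hΦx.comp (f := fun x : ℝ => (x, t)) (s := Set.univ) (by fun_prop)
    (fun x _ => ⟨Set.mem_univ _, ht⟩)
  simpa [Function.comp_def, continuousOn_univ] using this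

/-- Almost surely, Stratonovich minus Itô minus half Riemann sums vanish along dyadic grids. -/
lemma ae_tendsto_gridSum [IsProbabilityMeasure P] {B : ℝ≥0 → Ω → ℝ}
    (hBm : ∀ t, Measurable (B t)) (hB : IsBrownianReal B P)
    (hΦd : ∀ t ≤ T, Differentiable ℝ (fun x => Φ x t))
    (hΦx : ContinuousOn (fun p : ℝ × ℝ≥0 => partialX Φ p.1 p.2) (Set.univ ×ˢ Set.Iic T))
    (hab : a ≤ b) (hbT : b ≤ T) :
    ∀ᵐ ω ∂P, Tendsto (fun n : ℕ => gridSum (stratonovichTerm Φ B) a b (2 ^ n) ω -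
      gridSum (itoTerm Φ B) a b (2 ^ n) ω -
      1 / 2 * gridSum (riemannTerm (composed (partialX Φ) B)) a b (2 ^ n) ω) atTop (𝓝 0) := by
  have h1 := ae_tendsto_dyadic_quadratic hBm hB.toIsPreBrownianReal (T := T)
    (h := fun _ _ => 1) (C := 1) (fun _ _ => by fun_prop) (by simp) hab hbT
  -- One null set must serve all truncation levels, since the level is chosen after the path.
  have h2 := ae_all_iff.2 fun N : ℕ => ae_tendsto_dyadic_quadratic hBm hB.toIsPreBrownianReal
    (h := fun x t => clamp N (partialX Φ x t)) (C := N)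
    (fun t ht => (continuous_clamp N).measurable.comp (measurable_partialX hΦx ht))
    (fun x t => abs_clamp_le N _) hab hbT
  filter_upwards [h1, h2, hB.cont] with ω hω1 hω2 hc
  simp only [one_mul] at hω1
  exact tendsto_dyadic_of_quadratic (x := fun t => B t ω) hΦd hΦx hab hbT hc hω1 hω2

end StochSum

/-! ### Subdivision of partitions, and second moments of integrable processes. -/

namespace StochSum

variable {Ω : Type*} {mΩ : MeasurableSpace Ω} {P : Measure Ω} {T : ℝ≥0}

namespace TimePartition

variable (π : TimePartition T)

lemma t_mono {i j : ℕ} (hij : i ≤ j) (hj : j ≤ π.n) : π.t i ≤ π.t j := by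
  induction j, hij using Nat.le_induction with
  | base => exact le_rfl
  | succ k _ ih => exact (ih (by omega)).trans (π.t_lt k (by omega)).le

lemma t_le {i : ℕ} (hi : i ≤ π.n) : π.t i ≤ T := by
  simpa only [π.t_last] using π.t_mono hi le_rfl

lemma sub_le_mesh {i : ℕ} (hi : i < π.n) : π.t (i + 1) - π.t i ≤ π.mesh :=
  Finset.le_sup (f := fun i => π.t (i + 1) - π.t i) (Finset.mem_range.2 hi)

lemma exists_mem_Icc (hT : 0 < T) {t : ℝ≥0} (ht : t ≤ T) :
    ∃ j < π.n, t ∈ Set.Icc (π.t j) (π.t (j + 1)) := by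
  have hex : ∃ i, t ≤ π.t i := ⟨π.n, by rwa [π.t_last]⟩
  have hle : Nat.find hex ≤ π.n := Nat.find_min' hex (by rwa [π.t_last])
  have hn : 0 < π.n := by
    rw [pos_iff_ne_zero]
    intro h
    have := π.t_last
    rw [h, π.t_zero] at this
    exact hT.ne this
  rcases h : Nat.find hex with _ | k
  · have h0 : t ≤ π.t 0 := h ▸ Nat.find_spec hex
    refine ⟨0, hn, ?_, h0.trans (π.t_lt 0 hn).le⟩
    rw [π.t_zero]; exact zero_le
  · refine ⟨k, by omega, ?_, h ▸ Nat.find_spec hex⟩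
    exact (not_le.1 (Nat.find_min hex (m := k) (by omega))).le

/-- The uniform partition of `[0, T]` into `m` intervals. -/
noncomputable def uniform (hT : 0 < T) (m : ℕ) (hm : m ≠ 0) : TimePartition T where
  n := m
  t := gridPoint 0 T m
  t_zero := gridPoint_zero _ _ _
  t_last := gridPoint_last zero_le hm
  t_lt i _ := by
    rw [gridPoint_succ, tsub_zero]
    have : (0 : ℝ≥0) < m := by exact_mod_cast Nat.pos_of_ne_zero hm
    exact lt_add_of_pos_right _ (by positivity)

lemma mesh_uniform_le (hT : 0 < T) (m : ℕ) (hm : m ≠ 0) : (uniform hT m hm).mesh ≤ T / m := by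
  refine Finset.sup_le fun i _ => ?_
  simp only [uniform]
  rw [gridPoint_succ, tsub_zero, add_tsub_cancel_left]

lemma eventually_mesh_uniform_lt (hT : 0 < T) {δ : ℝ≥0} (hδ : 0 < δ) :
    ∀ᶠ k : ℕ in atTop, (uniform hT (2 ^ k) (by positivity)).mesh < δ := by
  have h : Tendsto (fun k : ℕ => T / ((2 ^ k : ℕ) : ℝ≥0)) atTop (𝓝 0) := by
    have := (tendsto_pow_atTop_nhds_zero_of_lt_one (r := (1 / 2 : ℝ≥0)) zero_le
      (by rw [← NNReal.coe_lt_coe]; norm_num)).const_mul T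
    rw [mul_zero] at this
    refine this.congr fun n => ?_
    push_cast
    rw [one_div, inv_pow, div_eq_mul_inv]
  exact (h.eventually_lt_const hδ).mono fun k hk => (mesh_uniform_le hT _ _).trans_lt hk

/-- Subdivision of the interval `[t j, t (j+1)]` into `m` intervals of equal length. -/
noncomputable def subdivide {j : ℕ} (hj : j < π.n) {m : ℕ} (hm : m ≠ 0) : TimePartition T where
  n := j + m + (π.n - (j + 1))
  -- Replacing one interval by `m` moves later indices up by `m - 1`. The truncated subtraction `i +
  -- 1 - m` is safe because there `i > j + m`.
  t i := if i < j then π.t i else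
    if i ≤ j + m then gridPoint (π.t j) (π.t (j + 1)) m (i - j) else π.t (i + 1 - m)
  t_zero := by
    rcases j.eq_zero_or_pos with rfl | h
    · simp [gridPoint_zero, π.t_zero]
    · simp [h, π.t_zero]
  t_last := by
    have hlast := gridPoint_last (π.t_lt j hj).le hm
    rw [if_neg (by omega)]
    split_ifs with h
    · have h1 : π.n = j + 1 := by omega
      have h2 : j + m + (π.n - (j + 1)) - j = m := by omega
      rw [h2, hlast, ← h1, π.t_last]
    · have h2 : j + m + (π.n - (j + 1)) + 1 - m = π.n := by omega
      rw [h2, π.t_last]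
  t_lt i hi := by
    have hlast := gridPoint_last (π.t_lt j hj).le hm
    rcases lt_trichotomy (i + 1) j with h | h | h
    · rw [if_pos (by omega), if_pos h]
      exact π.t_lt i (by omega)
    · rw [if_pos (by omega), if_neg (by omega), if_pos (by omega), h, Nat.sub_self,
        gridPoint_zero, ← h]
      exact π.t_lt i (by omega)
    · rw [if_neg (show ¬ i < j by omega), if_neg (show ¬ i + 1 < j by omega)]
      rcases lt_trichotomy i (j + m) with h' | h' | h'
      · rw [if_pos h'.le, if_pos (show i + 1 ≤ j + m from h'), Nat.sub_add_comm (by omega),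
          gridPoint_succ]
        have h1 : (0 : ℝ≥0) < m := by exact_mod_cast Nat.pos_of_ne_zero hm
        have h2 : 0 < π.t (j + 1) - π.t j := tsub_pos_of_lt (π.t_lt j hj)
        exact lt_add_of_pos_right _ (by positivity)
      · subst h'
        have h1 : j + m - j = m := by omega
        have h2 : j + m + 1 + 1 - m = j + 1 + 1 := by omega
        rw [if_pos le_rfl, if_neg (show ¬ j + m + 1 ≤ j + m by omega), h1, hlast, h2]
        exact π.t_lt _ (by omega)
      · have h2 : i + 1 + 1 - m = (i + 1 - m) + 1 := by omega
        rw [if_neg (show ¬ i ≤ j + m by omega), if_neg (show ¬ i + 1 ≤ j + m by omega), h2]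
        exact π.t_lt _ (by omega)

variable {j : ℕ} (hj : j < π.n) {m : ℕ} (hm : m ≠ 0)

lemma subdivide_t_left {i : ℕ} (hi : i ≤ j) : (π.subdivide hj hm).t i = π.t i := by
  simp only [subdivide]
  rcases hi.lt_or_eq with h | rfl
  · rw [if_pos h]
  · rw [if_neg (by omega), if_pos (by omega), Nat.sub_self, gridPoint_zero]

lemma subdivide_t_mid {i : ℕ} (hi : i ≤ m) :
    (π.subdivide hj hm).t (j + i) = gridPoint (π.t j) (π.t (j + 1)) m i := by
  simp only [subdivide]
  rw [if_neg (by omega), if_pos (by omega), Nat.add_sub_cancel_left]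

lemma subdivide_t_right (i : ℕ) : (π.subdivide hj hm).t (j + m + i) = π.t (j + 1 + i) := by
  rcases i.eq_zero_or_pos with rfl | h
  · rw [add_zero, subdivide_t_mid π hj hm le_rfl, gridPoint_last (π.t_lt j hj).le hm, add_zero]
  · simp only [subdivide]
    rw [if_neg (by omega), if_neg (by omega)]
    congr 1; omega

lemma mesh_subdivide_le : (π.subdivide hj hm).mesh ≤ π.mesh := by
  refine Finset.sup_le fun i hi => ?_
  have hi' : i < j + m + (π.n - (j + 1)) := Finset.mem_range.1 hi
  rcases lt_or_ge i j with h | h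
  · rw [subdivide_t_left π hj hm h, subdivide_t_left π hj hm h.le]
    exact π.sub_le_mesh (by omega)
  obtain ⟨k, rfl⟩ := Nat.exists_eq_add_of_le h
  rcases lt_or_ge k m with h' | h'
  · rw [add_assoc, subdivide_t_mid π hj hm h', subdivide_t_mid π hj hm h'.le, gridPoint_succ,
      add_tsub_cancel_left]
    refine le_trans ?_ (π.sub_le_mesh hj)
    exact div_le_self zero_le (by exact_mod_cast Nat.one_le_iff_ne_zero.2 hm)
  · obtain ⟨l, rfl⟩ := Nat.exists_eq_add_of_le h'
    rw [← add_assoc, add_assoc (j + m), subdivide_t_right π hj hm, subdivide_t_right π hj hm,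
      ← add_assoc]
    exact π.sub_le_mesh (by omega)

/-- Isolates a single term: up to the sum over its pieces, it is a difference of two complete sums,
each controlled by the existence of the integral. -/
lemma sum_subdivide (F : ℝ≥0 → ℝ≥0 → Ω → ℝ) (ω : Ω) :
    ∑ i ∈ Finset.range (π.subdivide hj hm).n,
        F ((π.subdivide hj hm).t i) ((π.subdivide hj hm).t (i + 1)) ω =
      ∑ i ∈ Finset.range π.n, F (π.t i) (π.t (i + 1)) ω - F (π.t j) (π.t (j + 1)) ω +
        gridSum F (π.t j) (π.t (j + 1)) m ω := by
  have hn : (π.subdivide hj hm).n = j + m + (π.n - (j + 1)) := rfl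
  have hn' : π.n = j + 1 + (π.n - (j + 1)) := by omega
  rw [hn]
  conv_rhs => rw [hn']
  rw [Finset.sum_range_add, Finset.sum_range_add, Finset.sum_range_add _ (j + 1),
    Finset.sum_range_succ _ j, gridSum]
  have e1 : ∀ i ∈ Finset.range j, F ((π.subdivide hj hm).t i) ((π.subdivide hj hm).t (i + 1)) ω =
      F (π.t i) (π.t (i + 1)) ω := fun i hi => by
    have := Finset.mem_range.1 hi
    rw [subdivide_t_left π hj hm this, subdivide_t_left π hj hm this.le]
  have e2 : ∀ i ∈ Finset.range m,
      F ((π.subdivide hj hm).t (j + i)) ((π.subdivide hj hm).t (j + i + 1)) ω =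
      F (gridPoint (π.t j) (π.t (j + 1)) m i) (gridPoint (π.t j) (π.t (j + 1)) m (i + 1)) ω :=
    fun i hi => by
    have := Finset.mem_range.1 hi
    rw [add_assoc, subdivide_t_mid π hj hm this, subdivide_t_mid π hj hm this.le]
  have e3 : ∀ i, F ((π.subdivide hj hm).t (j + m + i)) ((π.subdivide hj hm).t (j + m + i + 1)) ω =
      F (π.t (j + 1 + i)) (π.t (j + 1 + i + 1)) ω := fun i => by
    rw [add_assoc (j + m), subdivide_t_right π hj hm, subdivide_t_right π hj hm, ← add_assoc]
  rw [Finset.sum_congr rfl e1, Finset.sum_congr rfl e2, Finset.sum_congr rfl fun i _ => e3 i]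
  ring

end TimePartition

/-- A mean square integrable process has bounded second moments. -/
lemma IsMeanSquareIntegral.exists_eLpNorm_le (hT : 0 < T) {X : ℝ≥0 → Ω → ℝ} {Y : Ω → ℝ}
    (h : IsMeanSquareIntegral P T X Y) : ∃ M : ℝ≥0, ∀ t ≤ T, eLpNorm (X t) 2 P ≤ M := by
  obtain ⟨hX, hY, hlim⟩ := h
  -- A single fixed uniform partition, whose Riemann sums lie within `1` of `Y` for all tags, is
  -- enough.
  obtain ⟨δ, hδ, hδ'⟩ := (tendsto_comap_nhds_zero_iff _ _).1 hlim 1 one_pos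
  obtain ⟨k, hk⟩ := (TimePartition.eventually_mesh_uniform_lt hT hδ).exists
  set m := 2 ^ k
  set π := TimePartition.uniform hT m (by positivity)
  have hm : (0 : ℝ) < m := by positivity
  have hT' : (0 : ℝ) < T := hT
  have hstep : ∀ i, (π.t (i + 1) : ℝ) - π.t i = T / m := fun i => by
    have := gridPoint_succ_sub 0 T m i
    rw [tsub_zero] at this
    exact this
  have hXm : ∀ t ≤ T, AEStronglyMeasurable (X t) P := fun t ht => (hX t ht).1
  have htag0 : π.IsTag π.t := fun i hi => ⟨le_rfl, (π.t_lt i hi).le⟩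
  have hsumm : ∀ u : ℕ → ℝ≥0, π.IsTag u →
      AEStronglyMeasurable (fun ω => riemannSum X π u (Finset.range π.n) ω - Y ω) P := by
    intro u hu
    refine AEStronglyMeasurable.sub ?_ hY.1
    refine Finset.aestronglyMeasurable_fun_sum _ fun i hi => ?_
    have hi := Finset.mem_range.1 hi
    exact (hXm _ ((hu i hi).2.trans (π.t_le hi))).mul_const _
  have hfin : ∀ t ≤ T, eLpNorm (X t) 2 P = ((eLpNorm (X t) 2 P).toNNReal : ℝ≥0∞) := fun t ht =>
    (ENNReal.coe_toNNReal (hX t ht).2.ne).symm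
  -- `m / T` is the inverse step and `2` bounds the distance between two Riemann sums. The final sum
  -- dominates the norm at the left endpoint of whichever interval contains `t`.
  refine ⟨Real.toNNReal (m / T) * 2 + ∑ i ∈ Finset.range π.n, (eLpNorm (X (π.t i)) 2 P).toNNReal,
    fun t ht => ?_⟩
  obtain ⟨j, hj, htj⟩ := π.exists_mem_Icc hT ht
  -- Moving only the `j`-th tag from the left endpoint to `t` changes the Riemann sum by `(X t - X
  -- (π.t j)) * (T / m)`.
  set u := Function.update π.t j t
  have htag : π.IsTag u := fun i hi => by
    rcases eq_or_ne i j with rfl | hij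
    · simpa [u] using htj
    · simpa [u, hij] using htag0 i hi
  have hdiff : ∀ ω, X t ω = (m / T : ℝ) *
      ((riemannSum X π u (Finset.range π.n) ω - Y ω) -
        (riemannSum X π π.t (Finset.range π.n) ω - Y ω)) + X (π.t j) ω := by
    intro ω
    have : riemannSum X π u (Finset.range π.n) ω - riemannSum X π π.t (Finset.range π.n) ω =
        (X t ω - X (π.t j) ω) * (T / m) := by
      simp only [riemannSum, hstep]
      rw [← Finset.sum_sub_distrib, Finset.sum_eq_single j]
      · simp only [u, Function.update_self]; ring
      · intro i _ hij
        simp [u, hij]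
      · intro h; exact absurd (Finset.mem_range.2 hj) h
    rw [sub_sub_sub_cancel_right, this]
    field_simp
    ring
  have h2 : eLpNorm (fun ω => (riemannSum X π u (Finset.range π.n) ω - Y ω) -
        (riemannSum X π π.t (Finset.range π.n) ω - Y ω)) 2 P ≤ 2 := by
    refine (eLpNorm_sub_le (hsumm u htag) (hsumm π.t htag0) (by norm_num)).trans ?_
    have := add_le_add (hδ' ⟨(π, u), htag⟩ hk) (hδ' ⟨(π, π.t), htag0⟩ hk)
    rwa [one_add_one_eq_two] at this
  have hXeq : X t = (fun ω => (m / T : ℝ) *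
      ((riemannSum X π u (Finset.range π.n) ω - Y ω) -
        (riemannSum X π π.t (Finset.range π.n) ω - Y ω))) + X (π.t j) := funext hdiff
  have hjT : π.t j ≤ T := π.t_le hj.le
  rw [hXeq]
  refine (eLpNorm_add_le (((hsumm u htag).sub (hsumm π.t htag0)).const_mul _) (hXm _ hjT)
    (by norm_num)).trans ?_
  rw [ENNReal.coe_add]
  gcongr
  · have := eLpNorm_const_smul (m / T : ℝ) (fun ω =>
      (riemannSum X π u (Finset.range π.n) ω - Y ω) -
        (riemannSum X π π.t (Finset.range π.n) ω - Y ω)) 2 P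
    simp only [Pi.smul_def, smul_eq_mul] at this
    refine this.trans_le ?_
    rw [ENNReal.coe_mul, Real.enorm_eq_ofReal (by positivity)]
    gcongr
    · exact le_rfl
    · simpa using h2
  · rw [hfin _ hjT]
    exact_mod_cast Finset.single_le_sum (f := fun i => (eLpNorm (X (π.t i)) 2 P).toNNReal)
      (fun _ _ => zero_le) (Finset.mem_range.2 hj)

end StochSum

/-! ### Deletion of terms, uniform smallness of terms, and the conversion formula. -/

namespace StochSum

variable {Ω : Type*} {mΩ : MeasurableSpace Ω} {P : Measure Ω} {T : ℝ≥0}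

/-- Deleting `K` uniformly small terms does not change a limit in mean square. -/
lemma IsMeanSquareLimit.delete {ι κ : Type*} {size : ι → ℝ≥0} {size' : κ → ℝ≥0}
    {S : ι → Ω → ℝ} {Y : Ω → ℝ} (h : IsMeanSquareLimit P size S Y) (e : κ → ι)
    (he : ∀ a, size (e a) = size' a) {K : ℕ} {del : κ → Finset ℕ} (hK : ∀ a, (del a).card = K)
    {N : κ → ℕ} (hdel : ∀ a, del a ⊆ Finset.range (N a)) {f : κ → ℕ → Ω → ℝ}
    (hS : ∀ a ω, S (e a) ω = ∑ i ∈ Finset.range (N a), f a i ω)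
    (hm : ∀ a, ∀ i < N a, AEStronglyMeasurable (f a i) P)
    (hf : ∀ ε : ℝ≥0∞, 0 < ε → ∃ δ : ℝ≥0, 0 < δ ∧ ∀ a, size' a < δ → ∀ i < N a,
      eLpNorm (f a i) 2 P ≤ ε) :
    IsMeanSquareLimit P size' (fun a ω => ∑ i ∈ Finset.range (N a) \ del a, f a i ω) Y := by
  refine ⟨h.1, (tendsto_comap_nhds_zero_iff _ _).2 fun ε hε => ?_⟩
  have hε2 : 0 < ε / 2 := ENNReal.half_pos hε.ne'
  obtain ⟨δ₁, hδ₁, h₁⟩ := (tendsto_comap_nhds_zero_iff _ _).1 h.2 (ε / 2) hε2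
  -- `K + 1` rather than `K`, so that `K = 0` needs no separate case.
  obtain ⟨δ₂, hδ₂, h₂⟩ := hf (ε / 2 / (K + 1)) (ENNReal.div_pos hε2.ne' (by finiteness))
  refine ⟨min δ₁ δ₂, lt_min hδ₁ hδ₂, fun a ha => ?_⟩
  have hlt : ∀ i ∈ del a, i < N a := fun i hi => Finset.mem_range.1 (hdel a hi)
  have hSm : AEStronglyMeasurable (fun ω => S (e a) ω - Y ω) P := by
    simp only [hS]
    exact (Finset.aestronglyMeasurable_fun_sum _ fun i hi => hm a i (Finset.mem_range.1 hi)).sub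
      h.1.1
  have heq : (fun ω => ∑ i ∈ Finset.range (N a) \ del a, f a i ω - Y ω) =
      (fun ω => S (e a) ω - Y ω) - ∑ i ∈ del a, f a i := by
    ext ω
    rw [Pi.sub_apply, hS, ← Finset.sum_sdiff (hdel a), Finset.sum_apply]
    ring
  rw [heq]
  refine (eLpNorm_sub_le hSm (Finset.aestronglyMeasurable_sum _ fun i hi => hm a i (hlt i hi))
    (by norm_num)).trans ?_
  have hsum : eLpNorm (∑ i ∈ del a, f a i) 2 P ≤ ε / 2 := by
    calc _ ≤ ∑ i ∈ del a, eLpNorm (f a i) 2 P :=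
          eLpNorm_sum_le (fun i hi => hm a i (hlt i hi)) (by norm_num)
      _ ≤ ∑ i ∈ del a, ε / 2 / (K + 1) :=
          Finset.sum_le_sum fun i hi => h₂ a (ha.trans_le (min_le_right _ _)) i (hlt i hi)
      _ = K * (ε / 2 / (K + 1)) := by rw [Finset.sum_const, hK, nsmul_eq_mul]
      _ ≤ (K + 1) * (ε / 2 / (K + 1)) := by gcongr; exact le_self_add
      _ ≤ ε / 2 := ENNReal.mul_div_le
  calc _ ≤ ε / 2 + ε / 2 := by
        refine add_le_add (h₁ (e a) ?_) hsum
        rw [he]; exact ha.trans_le (min_le_left _ _)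
    _ = ε := ENNReal.add_halves ε

/-- If `f n → 0` a.e. and `‖Y - f n‖₂ ≤ c` eventually, then `‖Y‖₂ ≤ c`. -/
lemma eLpNorm_le_of_ae_tendsto_zero {Y : Ω → ℝ} {f : ℕ → Ω → ℝ} {c : ℝ≥0∞}
    (hY : AEStronglyMeasurable Y P) (hf : ∀ n, AEStronglyMeasurable (f n) P)
    (h0 : ∀ᵐ ω ∂P, Tendsto (fun n => f n ω) atTop (𝓝 0))
    (hc : ∀ᶠ n in atTop, eLpNorm (fun ω => Y ω - f n ω) 2 P ≤ c) : eLpNorm Y 2 P ≤ c := by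
  -- Fatou's lemma for `Y - f n → Y`; no `L²` convergence of `f n` is needed.
  refine Lp.eLpNorm_le_of_ae_tendsto hc (fun n => hY.sub (hf n)) ?_
  filter_upwards [h0] with ω hω
  simpa using hω.const_sub (Y ω)

lemma eLpNorm_mul_const_le {X : Ω → ℝ} {M : ℝ≥0} (hM : eLpNorm X 2 P ≤ M) (c : ℝ≥0) :
    eLpNorm (fun ω => X ω * (c : ℝ)) 2 P ≤ (M * c : ℝ≥0) := by
  have := eLpNorm_const_smul (c : ℝ) X 2 P
  simp only [Pi.smul_def, smul_eq_mul] at this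
  simp only [mul_comm _ (c : ℝ)]
  rw [this, mul_comm M, ENNReal.coe_mul, Real.enorm_eq_ofReal c.coe_nonneg, ENNReal.ofReal_coe_nnreal]
  gcongr

lemma exists_forall_lt_coe_le {g : ℝ≥0 → ℝ≥0} (hg : Continuous g) (hg0 : g 0 = 0) {ε : ℝ≥0∞}
    (hε : 0 < ε) : ∃ δ : ℝ≥0, 0 < δ ∧ ∀ d < δ, (g d : ℝ≥0∞) ≤ ε := by
  refine (tendsto_comap_nhds_zero_iff (fun d : ℝ≥0 => d) (fun d => (g d : ℝ≥0∞))).1 ?_ _ hε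
  rw [show comap (fun d : ℝ≥0 => d) (𝓝 0) = 𝓝 0 from comap_id]
  have := hg.tendsto 0
  rw [hg0] at this
  exact ENNReal.tendsto_coe.2 this

/-- No orthogonality is required: by the triangle inequality the weights `(b - a) / m` add up to `b
- a`. -/
lemma eLpNorm_riemann_gridSum_le {a b : ℝ≥0} {X : ℝ≥0 → Ω → ℝ}
    (hX : ∀ t ≤ T, Measurable (X t)) {M : ℝ≥0}
    (hM : ∀ t ≤ T, eLpNorm (X t) 2 P ≤ M) (hab : a ≤ b) (hbT : b ≤ T) {m : ℕ} (hm : m ≠ 0) :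
    eLpNorm (gridSum (riemannTerm X) a b m) 2 P ≤ (M * (b - a) : ℝ≥0) := by
  have hgT : ∀ i ∈ Finset.range m, gridPoint a b m i ≤ T := fun i hi =>
    (gridPoint_le hab (Finset.mem_range.1 hi).le).trans hbT
  have heq : gridSum (riemannTerm X) a b m =
      ∑ i ∈ Finset.range m, fun ω => X (gridPoint a b m i) ω * (((b - a) / m : ℝ≥0) : ℝ) := by
    ext ω
    rw [Finset.sum_apply]
    simp only [gridSum, riemannTerm, gridPoint_succ_sub]
    push_cast
    rfl
  rw [heq]
  refine (eLpNorm_sum_le (fun i hi => ((hX _ (hgT i hi)).mul_const _).aestronglyMeasurable)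
    (by norm_num)).trans ?_
  refine (Finset.sum_le_sum fun i hi => eLpNorm_mul_const_le (hM _ (hgT i hi)) _).trans ?_
  rw [Finset.sum_const, Finset.card_range, nsmul_eq_mul]
  have : (m : ℝ≥0) ≠ 0 := by exact_mod_cast hm
  apply le_of_eq
  rw [← ENNReal.coe_natCast, ← ENNReal.coe_mul]
  congr 1
  field_simp

section Moments

variable {X : ℝ≥0 → Ω → ℝ} {B : ℝ≥0 → Ω → ℝ}

lemma MemL0.exists_abs_le (h : MemL0 P T B X) : ∃ C : ℝ, ∀ t ≤ T, ∀ ω, |X t ω| ≤ C := by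
  obtain ⟨s, g, f, C, hs0, -, hs, -, -, hg, hf, hX0, hX⟩ := h
  refine ⟨C, fun t ht ω => ?_⟩
  obtain ⟨i, hi⟩ := (hs.eventually_ge_atTop t).exists
  have hex : ∃ i, t ≤ s i := ⟨i, hi⟩
  rcases h : Nat.find hex with _ | k
  · have h0 : t ≤ s 0 := h ▸ Nat.find_spec hex
    obtain rfl : t = 0 := le_antisymm (hs0 ▸ h0) zero_le
    rw [hX0]; exact hg ω
  · have h1 : t ≤ s (k + 1) := h ▸ Nat.find_spec hex
    have h2 : s k < t := not_le.1 (Nat.find_min hex (m := k) (by omega))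
    rw [hX k t ⟨h2, h1⟩ ht]; exact hf k ω

/-- In the `ℒ₂` case this is `x² ≤ 1 + x⁴`, integrated against a probability measure. -/
lemma exists_eLpNorm_le_of_moment [IsProbabilityMeasure P]
    (h : MemL0 P T B X ∨ (MemL2 P T B X ∧
      ∃ M : ℝ≥0, ∀ t ≤ T, ∫⁻ ω, ‖X t ω‖ₑ ^ 4 ∂P ≤ M)) :
    ∃ C : ℝ≥0, ∀ t ≤ T, eLpNorm (X t) 2 P ≤ C := by
  rcases h with h | ⟨-, M, hM⟩
  · obtain ⟨C, hC⟩ := h.exists_abs_le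
    refine ⟨C.toNNReal, fun t ht => ?_⟩
    have := eLpNorm_le_of_ae_bound (p := 2) (μ := P) (f := X t) (C := C) (ae_of_all _ (hC t ht))
    simpa [ENNReal.ofReal] using this
  · refine ⟨1 + M, fun t ht => ?_⟩
    have h1 : eLpNorm (X t) 2 P ^ 2 ≤ 1 + M := by
      rw [eLpNorm_two_sq]
      calc ∫⁻ ω, ‖X t ω‖ₑ ^ 2 ∂P ≤ ∫⁻ ω, 1 + ‖X t ω‖ₑ ^ 4 ∂P := by
            refine lintegral_mono fun ω => ?_
            rcases le_total ‖X t ω‖ₑ 1 with hx | hx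
            · exact (pow_le_one₀ zero_le hx).trans le_self_add
            · exact (pow_le_pow_right₀ hx (by norm_num)).trans le_add_self
        _ = 1 + ∫⁻ ω, ‖X t ω‖ₑ ^ 4 ∂P := by
            rw [lintegral_add_left measurable_const]; simp
        _ ≤ 1 + M := by gcongr; exact hM t ht
    refine (ENNReal.pow_le_pow_left_iff two_ne_zero).1 (h1.trans ?_)
    push_cast
    exact le_self_pow₀ le_self_add two_ne_zero

end Moments

variable [IsProbabilityMeasure P] {B : ℝ≥0 → Ω → ℝ} {Φ : ℝ → ℝ≥0 → ℝ} {s t a b : ℝ≥0}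

lemma eLpNorm_itoTerm_le (hBm : ∀ t, Measurable (B t)) (hB : IsPreBrownianReal B P)
    (hΦ : ∀ t ≤ T, Measurable fun x => Φ x t) {C : ℝ≥0}
    (hC : ∀ t ≤ T, eLpNorm (composed Φ B t) 2 P ≤ C) (hst : s ≤ t) (htT : t ≤ T) :
    eLpNorm (itoTerm Φ B s t) 2 P ≤ (C * NNReal.sqrt (t - s) : ℝ≥0) := by
  have := (eLpNorm_ito_grid_le hBm hB hΦ hC hst htT 1).2
  have h1 : gridPoint s t 1 1 = t := gridPoint_last hst one_ne_zero
  simp only [Finset.sum_range_one, gridPoint_zero, zero_add, h1] at this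
  exact this

lemma measurable_stratonovichTerm (hBm : ∀ t, Measurable (B t))
    (hΦ : ∀ t ≤ T, Measurable fun x => Φ x t) (hs : s ≤ T) :
    Measurable (stratonovichTerm Φ B s t) :=
  ((hΦ s hs).comp (((hBm s).add (hBm t)).div_const 2)).mul ((hBm t).sub (hBm s))

lemma measurable_itoTerm (hBm : ∀ t, Measurable (B t))
    (hΦ : ∀ t ≤ T, Measurable fun x => Φ x t) (hs : s ≤ T) :
    Measurable (itoTerm Φ B s t) :=
  ((hΦ s hs).comp (hBm s)).mul ((hBm t).sub (hBm s))

lemma measurable_gridSum {F : ℝ≥0 → ℝ≥0 → Ω → ℝ} (hF : ∀ s ≤ T, ∀ t, Measurable (F s t))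
    (hab : a ≤ b) (hbT : b ≤ T) (m : ℕ) : Measurable (gridSum F a b m) :=
  Finset.measurable_sum _ fun _ hi =>
    hF _ ((gridPoint_le hab (Finset.mem_range.1 hi).le).trans hbT) _

/-- The terms of the Stratonovich sums are uniformly small in `L²`. -/
lemma exists_eLpNorm_stratonovichTerm_le (hBm : ∀ t, Measurable (B t)) (hB : IsBrownianReal B P)
    (hΦd : ∀ t ≤ T, Differentiable ℝ (fun x => Φ x t))
    (hΦx : ContinuousOn (fun p : ℝ × ℝ≥0 => partialX Φ p.1 p.2) (Set.univ ×ˢ Set.Iic T))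
    {C M : ℝ≥0} (hC : ∀ t ≤ T, eLpNorm (composed Φ B t) 2 P ≤ C)
    (hM : ∀ t ≤ T, eLpNorm (composed (partialX Φ) B t) 2 P ≤ M)
    {S : Ω → ℝ} (hS : IsStratonovichIntegral P T Φ B S) {ε : ℝ≥0∞} (hε : 0 < ε) :
    ∃ δ : ℝ≥0, 0 < δ ∧ ∀ π : TimePartition T, π.mesh < δ → ∀ j < π.n,
      eLpNorm (stratonovichTerm Φ B (π.t j) (π.t (j + 1))) 2 P ≤ ε := by
  have hΦm : ∀ t ≤ T, Measurable fun x => Φ x t := fun t ht => (hΦd t ht).continuous.measurable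
  have hXm : ∀ t ≤ T, Measurable (composed (partialX Φ) B t) := fun t ht =>
    (measurable_partialX hΦx ht).comp (hBm t)
  have hε2 : 0 < ε / 2 := ENNReal.half_pos hε.ne'
  have hε4 : 0 < ε / 2 / 2 := ENNReal.half_pos hε2.ne'
  obtain ⟨δ₁, hδ₁, h₁⟩ := (tendsto_comap_nhds_zero_iff _ _).1 hS.2 _ hε4
  -- The function of `d` bounds the Itô and Riemann contributions of an interval of length `d`,
  -- however finely it is cut.
  obtain ⟨δ₂, hδ₂, h₂⟩ : ∃ δ : ℝ≥0, 0 < δ ∧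
      ∀ d : ℝ≥0, d < δ → ((C * NNReal.sqrt d + M * d : ℝ≥0) : ℝ≥0∞) ≤ ε / 2 :=
    exists_forall_lt_coe_le (g := fun d => C * NNReal.sqrt d + M * d) (by fun_prop) (by simp) hε2
  refine ⟨min δ₁ δ₂, lt_min hδ₁ hδ₂, fun π hπ j hj => ?_⟩
  set a := π.t j with ha
  set b := π.t (j + 1) with hb
  have hab : a ≤ b := (π.t_lt j hj).le
  have hbT : b ≤ T := π.t_le hj
  have hdδ : b - a < δ₂ := (π.sub_le_mesh hj).trans_lt (hπ.trans_le (min_le_right _ _))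
  have hsm : ∀ s ≤ T, ∀ t, Measurable (stratonovichTerm Φ B s t) := fun s hs t =>
    measurable_stratonovichTerm hBm hΦm hs
  have him : ∀ s ≤ T, ∀ t, Measurable (itoTerm Φ B s t) := fun s hs t =>
    measurable_itoTerm hBm hΦm hs
  have hrm : ∀ s ≤ T, ∀ t, Measurable (riemannTerm (composed (partialX Φ) B) s t) :=
    fun s hs t => (hXm s hs).mul_const _
  have hSm : ∀ π : TimePartition T, AEStronglyMeasurable
      (fun ω => stratonovichSum Φ B π (Finset.range π.n) ω - S ω) P := fun π =>
    (Finset.measurable_sum _ fun i hi =>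
      hsm _ (π.t_le (Finset.mem_range.1 hi).le) (π.t (i + 1))).aestronglyMeasurable.sub hS.1.1
  refine eLpNorm_le_of_ae_tendsto_zero
    (hsm a (hab.trans hbT) b).aestronglyMeasurable
    (f := fun n ω => gridSum (stratonovichTerm Φ B) a b (2 ^ n) ω -
      gridSum (itoTerm Φ B) a b (2 ^ n) ω -
      1 / 2 * gridSum (riemannTerm (composed (partialX Φ) B)) a b (2 ^ n) ω)
    (fun n => (((measurable_gridSum hsm hab hbT _).sub (measurable_gridSum him hab hbT _)).sub
      ((measurable_gridSum hrm hab hbT _).const_mul _)).aestronglyMeasurable)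
    (ae_tendsto_gridSum hBm hB hΦd hΦx hab hbT) (Eventually.of_forall fun n => ?_)
  have hm : 2 ^ n ≠ 0 := by positivity
  -- Subdividing does not increase the mesh, so the same `δ₁` works for every `n` and the bound
  -- passed to Fatou is uniform in `n`.
  set π' := π.subdivide hj hm
  have hπ' : π'.mesh < δ₁ :=
    (π.mesh_subdivide_le hj hm).trans_lt (hπ.trans_le (min_le_left _ _))
  set U : Ω → ℝ := fun ω => stratonovichSum Φ B π (Finset.range π.n) ω - S ω
  set U' : Ω → ℝ := fun ω => stratonovichSum Φ B π' (Finset.range π'.n) ω - S ω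
  set V : Ω → ℝ := gridSum (itoTerm Φ B) a b (2 ^ n)
  set W : Ω → ℝ := fun ω => gridSum (riemannTerm (composed (partialX Φ) B)) a b (2 ^ n) ω *
    ((1 / 2 : ℝ≥0) : ℝ)
  -- In `U - U'` the limit `S` and all terms outside `[a, b]` cancel, leaving the term minus the
  -- Stratonovich sum over its pieces.
  have heq : (fun ω => stratonovichTerm Φ B a b ω -
      (gridSum (stratonovichTerm Φ B) a b (2 ^ n) ω - gridSum (itoTerm Φ B) a b (2 ^ n) ω -
        1 / 2 * gridSum (riemannTerm (composed (partialX Φ) B)) a b (2 ^ n) ω)) =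
      (U - U') + (V + W) := by
    ext ω
    have := π.sum_subdivide hj hm (stratonovichTerm Φ B) ω
    simp only [Pi.add_apply, Pi.sub_apply, U, U', V, W]
    have e1 : stratonovichSum Φ B π' (Finset.range π'.n) ω =
        stratonovichSum Φ B π (Finset.range π.n) ω - stratonovichTerm Φ B a b ω +
          gridSum (stratonovichTerm Φ B) a b (2 ^ n) ω := this
    rw [e1]
    push_cast
    ring
  have hVm : AEStronglyMeasurable V P := (measurable_gridSum him hab hbT _).aestronglyMeasurable
  have hWm : AEStronglyMeasurable W P :=
    ((measurable_gridSum hrm hab hbT _).mul_const _).aestronglyMeasurable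
  have hU : eLpNorm U 2 P ≤ ε / 2 / 2 := h₁ π (hπ.trans_le (min_le_left _ _))
  have hU' : eLpNorm U' 2 P ≤ ε / 2 / 2 := h₁ π' hπ'
  have hV : eLpNorm V 2 P ≤ (C * NNReal.sqrt (b - a) : ℝ≥0) :=
    (eLpNorm_ito_grid_le hBm hB.toIsPreBrownianReal hΦm hC hab hbT _).2
  have hW : eLpNorm W 2 P ≤ (M * (b - a) : ℝ≥0) := by
    refine (eLpNorm_mul_const_le (eLpNorm_riemann_gridSum_le hXm hM hab hbT hm) _).trans ?_
    rw [ENNReal.coe_le_coe]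
    refine mul_le_of_le_one_right zero_le ?_
    rw [← NNReal.coe_le_coe]; norm_num
  rw [heq]
  calc _ ≤ eLpNorm (U - U') 2 P + eLpNorm (V + W) 2 P :=
        eLpNorm_add_le ((hSm π).sub (hSm π')) (hVm.add hWm) (by norm_num)
    _ ≤ (eLpNorm U 2 P + eLpNorm U' 2 P) + (eLpNorm V 2 P + eLpNorm W 2 P) :=
        add_le_add (eLpNorm_sub_le (hSm π) (hSm π') (by norm_num))
          (eLpNorm_add_le hVm hWm (by norm_num))
    _ ≤ (ε / 2 / 2 + ε / 2 / 2) + ε / 2 := by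
        refine add_le_add (add_le_add hU hU') ((add_le_add hV hW).trans ?_)
        rw [← ENNReal.coe_add]
        exact h₂ _ hdδ
    _ = ε := by rw [ENNReal.add_halves, ENNReal.add_halves]

/-- The conversion formula between the complete integrals. -/
lemma ae_eq_ito_add_half_riemann (hT : 0 < T) (hBm : ∀ t, Measurable (B t))
    (hB : IsBrownianReal B P) (hΦd : ∀ t ≤ T, Differentiable ℝ (fun x => Φ x t))
    (hΦx : ContinuousOn (fun p : ℝ × ℝ≥0 => partialX Φ p.1 p.2) (Set.univ ×ˢ Set.Iic T))
    {S I R : Ω → ℝ} (hS : IsStratonovichIntegral P T Φ B S) (hI : IsItoIntegral P T Φ B I)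
    (hR : IsMeanSquareIntegral P T (composed (partialX Φ) B) R) :
    S =ᵐ[P] fun ω => I ω + (1 / 2) * R ω := by
  have hΦm : ∀ t ≤ T, Measurable fun x => Φ x t := fun t ht => (hΦd t ht).continuous.measurable
  have hXm : ∀ t ≤ T, Measurable (composed (partialX Φ) B t) := fun t ht =>
    (measurable_partialX hΦx ht).comp (hBm t)
  have hYm : AEStronglyMeasurable (fun ω => S ω - (I ω + 1 / 2 * R ω)) P :=
    hS.1.1.sub (hI.1.1.add (hR.2.1.1.const_mul _))
  have hsm := measurable_gridSum (a := 0) (fun s hs t =>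
    measurable_stratonovichTerm (t := t) hBm hΦm hs) zero_le le_rfl
  have him := measurable_gridSum (a := 0) (fun s hs t =>
    measurable_itoTerm (t := t) hBm hΦm hs) zero_le le_rfl
  have hrm := measurable_gridSum (a := 0) (F := riemannTerm (composed (partialX Φ) B))
    (fun s hs t => (hXm s hs).mul_const _) zero_le le_rfl
  have hzero : eLpNorm (fun ω => S ω - (I ω + 1 / 2 * R ω)) 2 P = 0 := by
    refine le_antisymm (le_of_forall_gt_imp_ge_of_dense fun ε hε => ?_) zero_le
    have hε2 : 0 < ε / 2 := ENNReal.half_pos hε.ne'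
    have hε4 : 0 < ε / 2 / 2 := ENNReal.half_pos hε2.ne'
    obtain ⟨δ₁, hδ₁, h₁⟩ := (tendsto_comap_nhds_zero_iff _ _).1 hS.2 _ hε4
    obtain ⟨δ₂, hδ₂, h₂⟩ := (tendsto_comap_nhds_zero_iff _ _).1 hI.2 _ hε4
    obtain ⟨δ₃, hδ₃, h₃⟩ := (tendsto_comap_nhds_zero_iff _ _).1 hR.2.2 _ hε2
    -- Fatou again, now along the dyadic partitions of `[0, T]`, where the three complete sums are
    -- near their `L²` limits.
    refine eLpNorm_le_of_ae_tendsto_zero hYm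
      (fun n => (((hsm (2 ^ n)).sub (him (2 ^ n))).sub
        ((hrm (2 ^ n)).const_mul (1 / 2))).aestronglyMeasurable)
      (ae_tendsto_gridSum hBm hB hΦd hΦx zero_le le_rfl) ?_
    filter_upwards [TimePartition.eventually_mesh_uniform_lt hT
      (lt_min hδ₁ (lt_min hδ₂ hδ₃))] with n hn
    set π := TimePartition.uniform hT (2 ^ n) (by positivity)
    have htag : π.IsTag π.t := fun i hi => ⟨le_rfl, (π.t_lt i hi).le⟩
    set U : Ω → ℝ := fun ω => stratonovichSum Φ B π (Finset.range π.n) ω - S ω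
    set V : Ω → ℝ := fun ω => itoSum Φ B π (Finset.range π.n) ω - I ω
    set W : Ω → ℝ := fun ω =>
      riemannSum (composed (partialX Φ) B) π π.t (Finset.range π.n) ω - R ω
    have hU : eLpNorm U 2 P ≤ ε / 2 / 2 := h₁ π (hn.trans_le (min_le_left _ _))
    have hV : eLpNorm V 2 P ≤ ε / 2 / 2 :=
      h₂ π (hn.trans_le ((min_le_right _ _).trans (min_le_left _ _)))
    have hW : eLpNorm W 2 P ≤ ε / 2 :=
      h₃ ⟨(π, π.t), htag⟩ (hn.trans_le ((min_le_right _ _).trans (min_le_right _ _)))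
    have hUm : AEStronglyMeasurable U P := (hsm (2 ^ n)).aestronglyMeasurable.sub hS.1.1
    have hVm : AEStronglyMeasurable V P := (him (2 ^ n)).aestronglyMeasurable.sub hI.1.1
    have hWm : AEStronglyMeasurable W P := (hrm (2 ^ n)).aestronglyMeasurable.sub hR.2.1.1
    have hW2 : eLpNorm ((1 / 2 : ℝ) • W) 2 P ≤ ε / 2 := by
      rw [eLpNorm_const_smul, Real.enorm_eq_ofReal (by norm_num)]
      refine (mul_le_of_le_one_left zero_le ?_).trans hW
      rw [ENNReal.ofReal_le_one]; norm_num
    have heq : (fun ω => S ω - (I ω + 1 / 2 * R ω) -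
        (gridSum (stratonovichTerm Φ B) 0 T (2 ^ n) ω - gridSum (itoTerm Φ B) 0 T (2 ^ n) ω -
        1 / 2 * gridSum (riemannTerm (composed (partialX Φ) B)) 0 T (2 ^ n) ω)) =
        (V - U) + (1 / 2 : ℝ) • W := by
      ext ω
      -- Complete sums over the uniform partition are by definition grid sums on `[0, T]`.
      have e1 : U ω = gridSum (stratonovichTerm Φ B) 0 T (2 ^ n) ω - S ω := rfl
      have e2 : V ω = gridSum (itoTerm Φ B) 0 T (2 ^ n) ω - I ω := rfl
      have e3 : W ω = gridSum (riemannTerm (composed (partialX Φ) B)) 0 T (2 ^ n) ω - R ω := rfl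
      simp only [Pi.add_apply, Pi.sub_apply, Pi.smul_apply, smul_eq_mul, e1, e2, e3]
      ring
    refine (congrArg (eLpNorm · 2 P) heq).trans_le ?_
    calc _ ≤ eLpNorm (V - U) 2 P + eLpNorm ((1 / 2 : ℝ) • W) 2 P :=
          eLpNorm_add_le (hVm.sub hUm) (hWm.const_smul _) (by norm_num)
      _ ≤ (eLpNorm V 2 P + eLpNorm U 2 P) + eLpNorm ((1 / 2 : ℝ) • W) 2 P := by
          gcongr
          exact eLpNorm_sub_le hVm hUm (by norm_num)
      _ ≤ (ε / 2 / 2 + ε / 2 / 2) + ε / 2 := by gcongr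
      _ = ε := by rw [ENNReal.add_halves, ENNReal.add_halves]
  filter_upwards [(eLpNorm_eq_zero_iff hYm two_ne_zero).1 hzero] with ω hω
  exact sub_eq_zero.1 hω

end StochSum

theorem theorem4 {Ω : Type*} {mΩ : MeasurableSpace Ω} (P : Measure Ω) [IsProbabilityMeasure P]
    (B : ℝ≥0 → Ω → ℝ) (hBm : ∀ t, Measurable (B t)) (hB : IsBrownianReal B P)
    (T : ℝ≥0) (hT : 0 < T) (K : ℕ) (Φ : ℝ → ℝ≥0 → ℝ)
    -- `Φ` is continuous in `t` and has a continuous partial derivative in `x`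
    (hΦt : ∀ x, ContinuousOn (fun t => Φ x t) (Set.Iic T))
    (hΦd : ∀ t ≤ T, Differentiable ℝ (fun x => Φ x t))
    (hΦx : ContinuousOn (fun p : ℝ × ℝ≥0 => StochSum.partialX Φ p.1 p.2)
      (Set.univ ×ˢ Set.Iic T))
    -- `Φ(B(t), t)` is non-anticipating, and in `ℒ₀`, or in `ℒ₂` with bounded fourth moments
    (hadapt : StochSum.IsNonanticipating P T B (StochSum.composed Φ B))
    (hmoment : StochSum.MemL0 P T B (StochSum.composed Φ B) ∨
      (StochSum.MemL2 P T B (StochSum.composed Φ B) ∧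
        ∃ M : ℝ≥0, ∀ t ≤ T, ∫⁻ ω, ‖StochSum.composed Φ B t ω‖ₑ ^ 4 ∂P ≤ M))
    -- `∂Φ/∂x(B(t), t)` is in `ℒ₂`, with bounded or Riemann integrable second moments
    (hderivL2 : StochSum.MemL2 P T B (StochSum.composed (StochSum.partialX Φ) B))
    (hderiv :
      (∃ M : ℝ≥0, ∀ t ≤ T,
        ∫⁻ ω, ‖StochSum.composed (StochSum.partialX Φ) B t ω‖ₑ ^ 2 ∂P ≤ M) ∨
      ((∀ t ≤ T, MemLp (StochSum.composed (StochSum.partialX Φ) B t) 2 P) ∧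
        StochSum.IsRiemannIntegrable T
          (fun t => ∫ ω, (StochSum.composed (StochSum.partialX Φ) B t ω) ^ 2 ∂P)))
    -- the three integrals exist
    (S I R : Ω → ℝ)
    (hS : StochSum.IsStratonovichIntegral P T Φ B S)
    (hI : StochSum.IsItoIntegral P T Φ B I)
    (hR : StochSum.IsMeanSquareIntegral P T (StochSum.composed (StochSum.partialX Φ) B) R) :
    StochSum.IsIncompleteStratonovichLimit P T K Φ B S ∧
    StochSum.IsIncompleteItoLimit P T K Φ B I ∧
    StochSum.IsIncompleteRiemannLimit P T K (StochSum.composed (StochSum.partialX Φ) B) R ∧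
    S =ᵐ[P] fun ω => I ω + (1 / 2) * R ω := by
  have hΦm : ∀ t ≤ T, Measurable fun x => Φ x t := fun t ht => (hΦd t ht).continuous.measurable
  obtain ⟨C, hC⟩ := StochSum.exists_eLpNorm_le_of_moment hmoment
  -- The bound on the second moments of `∂Φ/∂x` is drawn from the existence of its mean-square
  -- integral.
  obtain ⟨M, hM⟩ := hR.exists_eLpNorm_le hT
  refine ⟨?_, ?_, ?_, StochSum.ae_eq_ito_add_half_riemann hT hBm hB hΦd hΦx hS hI hR⟩
  · refine hS.delete (fun π : StochSum.DeletedPartition T K => π.toTimePartition) (fun _ => rfl)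
      (fun π => π.card_del) (fun π => π.del_subset)
      (f := fun π i => StochSum.stratonovichTerm Φ B (π.t i) (π.t (i + 1))) (fun _ _ => rfl)
      (fun π i hi => (StochSum.measurable_stratonovichTerm hBm hΦm
        (π.t_le hi.le)).aestronglyMeasurable) fun ε hε => ?_
    obtain ⟨δ, hδ, h⟩ := StochSum.exists_eLpNorm_stratonovichTerm_le hBm hB hΦd hΦx hC hM hS hε
    exact ⟨δ, hδ, fun π hπ i hi => h π.toTimePartition hπ i hi⟩
  · refine hI.delete (fun π : StochSum.DeletedPartition T K => π.toTimePartition) (fun _ => rfl)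
      (fun π => π.card_del) (fun π => π.del_subset)
      (f := fun π i => StochSum.itoTerm Φ B (π.t i) (π.t (i + 1))) (fun _ _ => rfl)
      (fun π i hi => (StochSum.measurable_itoTerm hBm hΦm
        (π.t_le hi.le)).aestronglyMeasurable) fun ε hε => ?_
    obtain ⟨δ, hδ, h⟩ := StochSum.exists_forall_lt_coe_le (g := fun d => C * NNReal.sqrt d)
      (by fun_prop) (by simp) hε
    exact ⟨δ, hδ, fun π hπ i hi => (StochSum.eLpNorm_itoTerm_le hBm hB.toIsPreBrownianReal hΦm hC
      (π.t_lt i hi).le (π.t_le hi)).trans (h _ ((π.sub_le_mesh hi).trans_lt hπ))⟩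
  · refine hR.2.delete (fun π : StochSum.TaggedDeletedPartition T K =>
        ⟨(π.toTimePartition, π.u), π.isTag⟩) (fun _ => rfl)
      (fun π => π.card_del) (fun π => π.del_subset)
      (f := fun π i ω => StochSum.composed (StochSum.partialX Φ) B (π.u i) ω *
        ((π.t (i + 1) : ℝ) - (π.t i : ℝ))) (fun _ _ => rfl)
      (fun π i hi => (hR.1 _ ((π.isTag i hi).2.trans (π.t_le hi))).1.mul_const _) fun ε hε => ?_
    obtain ⟨δ, hδ, h⟩ := StochSum.exists_forall_lt_coe_le (g := fun d => M * d)
      (by fun_prop) (by simp) hε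
    refine ⟨δ, hδ, fun π hπ i hi => ?_⟩
    refine le_trans ?_ (h _ ((π.sub_le_mesh hi).trans_lt hπ))
    rw [← NNReal.coe_sub (π.t_lt i hi).le]
    exact StochSum.eLpNorm_mul_const_le (hM _ ((π.isTag i hi).2.trans (π.t_le hi))) _
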